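/- Let $k$ be a commutative ring; algebras are associative unital $k$-algebras and $\otimes=\otimes_k$. Let $A$ be a commutative algebra with an algebra endomorphism $\alpha:A\to A$. Let $\Omega^1A=\ker(A\otimes A\to A)$ be the kernel of the multiplication, with $da=1\otimes a-a\otimes 1$; let $\Omega^*A=T_A(\Omega^1A)$ be the differential graded algebra of universal differential forms (the tensor algebra of the $A$-bimodule $\Omega^1A$, with the derivation $d$ of degree $1$ and square zero that extends $d:A\to\Omega^1A$); and let $\Omega^*_\alpha A$ be its quotient by the two-sided differential ideal generated by the elements $da\,b-\alpha(b)\,da$ with $a,b\in A$. It is a differential graded algebra with $\Omega^0_\alpha A=A$, functorial with respect to algebra morphisms $f:A\to B$ such that $f\alpha=\beta f$, which are the morphisms $(A,\alpha)\to(B,\beta)$; in particular $\alpha$ induces an endomorphism of $\Omega^*_\alpha A$, again written $\alpha$. A braiding of an algebra $B$ with multiplication $\mu$ and unit $\eta$ is a $k$-linear map $R:B\otimes B\to B\otimes B$ such that $$R(\eta\otimes1)=1\otimes\eta,\qquad R(1\otimes\eta)=\eta\otimes 1,$$ $$(R\otimes1)(1\otimes R)(R\otimes1)=(1\otimes R)(R\otimes1)(1\otimes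 R),$$ $$(\mu\otimes1)(1\otimes R)(R\otimes1)=R(1\otimes\mu),\qquad(1\otimes\mu)(R\otimes1)(1\otimes R)=R(\mu\otimes1),\qquad \mu R=\mu.$$ If $B$ is a differential graded algebra, $R$ is a braiding of differential graded algebras if moreover it preserves the total degree and commutes with the usual differential $x\otimes y\mapsto dx\otimes y+(-1)^{|x|}x\otimes dy$ of $B\otimes B$. Theorem. There is exactly one way to assign, functorially in $(A,\alpha)$, to each endomorphism $\alpha:A\to A$ of a commutative algebra a braiding of differential graded algebras $R$ on $\Omega^*_\alpha A$ such that $R(a\otimes b)=b\otimes a$ for all $a,b\in A=\Omega^0_\alpha A$. It is given, for homogeneous forms $\omega,\phi\in\Omega^*_\alpha A$ of degrees $|\omega|,|\phi|$, by $$R(\omega\otimes\phi)=(-1)^{|\omega||\phi|}\,\alpha^{|\omega|}(\phi)\otimes\omega-(-1)^{(|\omega|+1)|\phi|}\,I\bigl(\alpha^{|\omega|}(\phi)\bigr)\otimes d\omega,$$ where $I:\Omega^*_\alpha A\to\Omega^*_\alpha A$ is the (well-defined) $k$-linear map of degree $-1$ with $$I(u_0\,du_1\cdots du_n)=\sum_{i=1}^n(-1)^{i+1}u_0\,du_1\cdots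 du_{i-1}\,(u_i-\alpha(u_i))\,d\alpha(u_{i+1})\cdots d\alpha(u_n);$$ it satisfies $dI+Id=1-\alpha$ and $I^2=0$. -/

import Mathlib

open scoped TensorProduct DirectSum

universe u v

noncomputable section

namespace TwistedForms

/-! ### Differential graded algebras -/

section DG

variable {k : Type*} [CommRing k] {B : Type*} [Ring B] [Algebra k B]

variable (k B) in
/-- A structure of cohomologically graded differential algebra on the associative unital
`k`-algebra `B`: a grading by `ℕ`, and a `k`-linear differential of degree `+1` and square zero
that satisfies the graded Leibniz rule. -/
structure DGStructure where
  /-- the homogeneous components -/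
  deg : ℕ → Submodule k B
  /-- `B` is the direct sum of its homogeneous components, as a graded algebra -/
  gr : GradedAlgebra deg
  /-- the differential -/
  d : B →ₗ[k] B
  d_mem : ∀ (n : ℕ) (x : B), x ∈ deg n → d x ∈ deg (n + 1)
  d_d : ∀ x : B, d (d x) = 0
  leibniz : ∀ (n : ℕ) (x y : B), x ∈ deg n → d (x * y) = d x * y + (-1 : k) ^ n • (x * d y)

attribute [instance] DGStructure.gr

namespace DGStructure

variable (D : DGStructure k B)

/-- The sign map `x ↦ (-1) ^ |x| x`. -/
def sgn : B →ₗ[k] B :=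
  DirectSum.toModule k ℕ B (fun n => (-1 : k) ^ n • (D.deg n).subtype) ∘ₗ
    (DirectSum.decomposeLinearEquiv D.deg).toLinearMap

theorem sgn_of_mem {n : ℕ} {x : B} (hx : x ∈ D.deg n) : D.sgn x = (-1 : k) ^ n • x := by
  simp only [sgn, LinearMap.comp_apply, LinearEquiv.coe_coe, DirectSum.decomposeLinearEquiv_apply,
    DirectSum.decompose_of_mem D.deg hx]
  exact DirectSum.toModule_lof k n _

/-- The degree `n` part of `B ⊗ B`, the sum of the images of `B_p ⊗ B_q` for `p + q = n`. -/
def tensorDeg (n : ℕ) : Submodule k (B ⊗[k] B) :=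
  Submodule.span k {t | ∃ p q : ℕ, p + q = n ∧ ∃ x ∈ D.deg p, ∃ y ∈ D.deg q, t = x ⊗ₜ[k] y}

/-- The usual differential `x ⊗ y ↦ d x ⊗ y + (-1) ^ |x| x ⊗ d y` of `B ⊗ B`. -/
def tensorD : B ⊗[k] B →ₗ[k] B ⊗[k] B :=
  TensorProduct.map D.d LinearMap.id + TensorProduct.map D.sgn D.d

theorem tensorD_tmul {n : ℕ} {x : B} (hx : x ∈ D.deg n) (y : B) :
    D.tensorD (x ⊗ₜ[k] y) = D.d x ⊗ₜ[k] y + (-1 : k) ^ n • (x ⊗ₜ[k] D.d y) := by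
  simp [tensorD, D.sgn_of_mem hx, TensorProduct.smul_tmul']

/-- `R : B ⊗ B → B ⊗ B` is a morphism of differential graded modules. -/
structure IsDGMap (R : B ⊗[k] B →ₗ[k] B ⊗[k] B) : Prop where
  map_deg : ∀ (n : ℕ) (t : B ⊗[k] B), t ∈ D.tensorDeg n → R t ∈ D.tensorDeg n
  comm_d : R ∘ₗ D.tensorD = D.tensorD ∘ₗ R

end DGStructure

/-! ### Braidings -/

/-- `φ ⊗ 1` on `B ⊗ B ⊗ B`, for `φ : B ⊗ B → B ⊗ B`. -/
def on12 (φ : B ⊗[k] B →ₗ[k] B ⊗[k] B) : B ⊗[k] (B ⊗[k] B) →ₗ[k] B ⊗[k] (B ⊗[k] B) :=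
  (TensorProduct.assoc k B B B).toLinearMap ∘ₗ TensorProduct.map φ LinearMap.id ∘ₗ
    (TensorProduct.assoc k B B B).symm.toLinearMap

/-- `1 ⊗ φ` on `B ⊗ B ⊗ B`, for `φ : B ⊗ B → B ⊗ B`. -/
def on23 (φ : B ⊗[k] B →ₗ[k] B ⊗[k] B) : B ⊗[k] (B ⊗[k] B) →ₗ[k] B ⊗[k] (B ⊗[k] B) :=
  TensorProduct.map LinearMap.id φ

variable (k B) in
/-- `μ ⊗ 1`, for the multiplication `μ` of `B`. -/
def mul12 : B ⊗[k] (B ⊗[k] B) →ₗ[k] B ⊗[k] B :=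
  TensorProduct.map (LinearMap.mul' k B) LinearMap.id ∘ₗ
    (TensorProduct.assoc k B B B).symm.toLinearMap

variable (k B) in
/-- `1 ⊗ μ`, for the multiplication `μ` of `B`. -/
def mul23 : B ⊗[k] (B ⊗[k] B) →ₗ[k] B ⊗[k] B :=
  TensorProduct.map LinearMap.id (LinearMap.mul' k B)

/-- A braiding on the associative unital `k`-algebra `B`. -/
structure IsBraiding (R : B ⊗[k] B →ₗ[k] B ⊗[k] B) : Prop where
  unit_left : ∀ x : B, R (1 ⊗ₜ[k] x) = x ⊗ₜ[k] 1
  unit_right : ∀ x : B, R (x ⊗ₜ[k] 1) = 1 ⊗ₜ[k] x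
  yang_baxter : on12 R ∘ₗ on23 R ∘ₗ on12 R = on23 R ∘ₗ on12 R ∘ₗ on23 R
  compat_right : mul12 k B ∘ₗ on23 R ∘ₗ on12 R = R ∘ₗ mul23 k B
  compat_left : mul23 k B ∘ₗ on12 R ∘ₗ on23 R = R ∘ₗ mul12 k B
  mul_comp : LinearMap.mul' k B ∘ₗ R = LinearMap.mul' k B

/-- A braiding of differential graded algebras. -/
structure DGStructure.IsDGBraiding (D : DGStructure k B) (R : B ⊗[k] B →ₗ[k] B ⊗[k] B) : Prop
    extends IsBraiding R, D.IsDGMap R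

/-! ### Differential ideals and quotients -/

namespace DGStructure

variable (D : DGStructure k B)

/-- The differential ideal generated by `S`: the smallest two-sided ideal that contains `S` and
is stable under the differential. -/
def diffIdeal (S : Set B) : Ideal B :=
  sInf {J : Ideal B | J.IsTwoSided ∧ (∀ x ∈ J, D.d x ∈ J) ∧ S ⊆ J}

theorem mem_diffIdeal {S : Set B} {x : B} : x ∈ D.diffIdeal S ↔
    ∀ J : Ideal B, J.IsTwoSided → (∀ y ∈ J, D.d y ∈ J) → S ⊆ J → x ∈ J := by
  simp [diffIdeal, Submodule.mem_sInf]

instance diffIdeal_isTwoSided (S : Set B) : (D.diffIdeal S).IsTwoSided where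
  mul_mem_of_left b h := by
    rw [mem_diffIdeal] at h ⊢
    intro J h1 h2 h3
    exact h1.mul_mem_of_left b (h J h1 h2 h3)

theorem subset_diffIdeal (S : Set B) : S ⊆ D.diffIdeal S := by
  intro x hx
  rw [SetLike.mem_coe, mem_diffIdeal]
  exact fun J _ _ h => h hx

theorem d_mem_diffIdeal {S : Set B} {x : B} (hx : x ∈ D.diffIdeal S) : D.d x ∈ D.diffIdeal S := by
  rw [mem_diffIdeal] at hx ⊢
  exact fun J h1 h2 h3 => h2 _ (hx J h1 h2 h3)

/-- The homogeneous component of degree `n`. -/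
def comp (n : ℕ) : B →ₗ[k] B :=
  (D.deg n).subtype ∘ₗ DirectSum.component k ℕ (fun i => D.deg i) n ∘ₗ
    (DirectSum.decomposeLinearEquiv D.deg).toLinearMap

theorem comp_apply (n : ℕ) (x : B) : D.comp n x = (DirectSum.decompose D.deg x n : B) := rfl

theorem comp_mem (n : ℕ) (x : B) : D.comp n x ∈ D.deg n := by
  rw [comp_apply]; exact SetLike.coe_mem _

theorem comp_of_mem {n : ℕ} {x : B} (hx : x ∈ D.deg n) (m : ℕ) :
    D.comp m x = if m = n then x else 0 := by
  rw [comp_apply]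
  split_ifs with h
  · subst h; exact DirectSum.decompose_of_mem_same _ hx
  · exact DirectSum.decompose_of_mem_ne _ hx (Ne.symm h)

theorem induction_deg {P : B → Prop} (hadd : ∀ x y, P x → P y → P (x + y))
    (h : ∀ n, ∀ x ∈ D.deg n, P x) (x : B) : P x := by
  classical
  have h0 : P 0 := h 0 0 (zero_mem _)
  rw [← DirectSum.sum_support_decompose D.deg x]
  exact Finset.sum_induction _ P hadd h0 fun i _ => h i _ (SetLike.coe_mem _)

/-- An ideal generated, as a differential ideal, by homogeneous elements is homogeneous. -/
theorem comp_mem_diffIdeal {S : Set B} (hS : ∀ x ∈ S, ∃ n, x ∈ D.deg n) {x : B}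
    (hx : x ∈ D.diffIdeal S) (n : ℕ) : D.comp n x ∈ D.diffIdeal S := by
  -- the components of a product with a homogeneous element
  have hl : ∀ (p : ℕ) (b : B), b ∈ D.deg p → ∀ y : B, ∀ m,
      D.comp m (b * y) = if p ≤ m then b * D.comp (m - p) y else 0 := by
    intro p b hb y m
    rw [comp_apply, comp_apply, DirectSum.coe_decompose_mul_of_left_mem D.deg m hb]
  have hr : ∀ (p : ℕ) (b : B), b ∈ D.deg p → ∀ y : B, ∀ m,
      D.comp m (y * b) = if p ≤ m then D.comp (m - p) y * b else 0 := by
    intro p b hb y m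
    rw [comp_apply, comp_apply, DirectSum.coe_decompose_mul_of_right_mem D.deg m hb]
  have hd : ∀ (y : B) m, D.comp (m + 1) (D.d y) = D.d (D.comp m y) := by
    intro y m
    induction y using D.induction_deg with
    | hadd x y hx hy => simp only [map_add, hx, hy]
    | h p y hy =>
      rw [D.comp_of_mem hy, D.comp_of_mem (D.d_mem p y hy)]
      by_cases h : m = p <;> simp [h]
  have hd0 : ∀ y : B, D.comp 0 (D.d y) = 0 := by
    intro y
    induction y using D.induction_deg with
    | hadd x y hx hy => simp only [map_add, hx, hy, add_zero]
    | h p y hy => rw [D.comp_of_mem (D.d_mem p y hy)]; simp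
  let J : Ideal B :=
    { carrier := {x | ∀ m, D.comp m x ∈ D.diffIdeal S}
      add_mem' := fun {a b} ha hb m => by
        rw [map_add]; exact add_mem (ha m) (hb m)
      zero_mem' := fun m => by rw [map_zero]; exact zero_mem _
      smul_mem' := fun c y hy => by
        induction c using D.induction_deg with
        | hadd a b ha hb =>
          intro m
          rw [add_smul, map_add]; exact add_mem (ha m) (hb m)
        | h p b hb =>
          intro m
          rw [smul_eq_mul, hl p b hb]
          split_ifs
          · exact Ideal.mul_mem_left _ _ (hy _)
          · exact zero_mem _ }
  have hJ : J.IsTwoSided := ⟨fun {a} b ha => by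
    induction b using D.induction_deg with
    | hadd c e hc he => rw [mul_add]; exact add_mem hc he
    | h p b hb =>
      intro m
      rw [hr p b hb]
      split_ifs
      · exact Ideal.mul_mem_right _ _ (ha _)
      · exact zero_mem _⟩
  refine (D.mem_diffIdeal.1 hx J hJ ?_ ?_) n
  · intro y hy m
    cases m with
    | zero => rw [hd0]; exact zero_mem _
    | succ m => rw [hd]; exact D.d_mem_diffIdeal (hy m)
  · intro y hy m
    obtain ⟨p, hp⟩ := hS y hy
    rw [D.comp_of_mem hp]
    split_ifs
    · exact D.subset_diffIdeal S hy
    · exact zero_mem _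

/-- A linear map that vanishes on an ideal descends to the quotient. -/
def quotLift {C : Type*} [AddCommMonoid C] [Module k C] (J : Ideal B) [J.IsTwoSided]
    (f : B →ₗ[k] C) (h : ∀ x ∈ J, f x = 0) : (B ⧸ J) →ₗ[k] C where
  toFun q := Quotient.liftOn' q f (fun x y hxy => by
    have h1 := h _ ((Submodule.quotientRel_def J).1 hxy)
    rw [← sub_add_cancel x y, map_add, h1, zero_add])
  map_add' := by rintro ⟨x⟩ ⟨y⟩; exact map_add f x y
  map_smul' := by rintro c ⟨x⟩; exact map_smul f c x

@[simp] theorem quotLift_mk {C : Type*} [AddCommMonoid C] [Module k C] (J : Ideal B)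
    [J.IsTwoSided] (f : B →ₗ[k] C) (h : ∀ x ∈ J, f x = 0) (x : B) :
    quotLift J f h (Ideal.Quotient.mkₐ k J x) = f x := rfl

/-- The homogeneous components of the quotient by an ideal. -/
def quotDeg (J : Ideal B) [J.IsTwoSided] (n : ℕ) : Submodule k (B ⧸ J) :=
  (D.deg n).map (Ideal.Quotient.mkₐ k J).toLinearMap

theorem mk_mem_quotDeg (J : Ideal B) [J.IsTwoSided] {n : ℕ} {x : B} (hx : x ∈ D.deg n) :
    Ideal.Quotient.mkₐ k J x ∈ D.quotDeg J n := ⟨x, hx, rfl⟩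

instance quotDeg_gradedMonoid (J : Ideal B) [J.IsTwoSided] :
    SetLike.GradedMonoid (D.quotDeg J) where
  one_mem := ⟨1, SetLike.GradedOne.one_mem, map_one (Ideal.Quotient.mkₐ k J)⟩
  mul_mem := by
    rintro i j _ _ ⟨x, hx, rfl⟩ ⟨y, hy, rfl⟩
    exact ⟨x * y, SetLike.GradedMul.mul_mem hx hy, map_mul (Ideal.Quotient.mkₐ k J) x y⟩

/-- The projection onto the quotient, on homogeneous components. -/
def quotDegMk (J : Ideal B) [J.IsTwoSided] (n : ℕ) : D.deg n →ₗ[k] D.quotDeg J n :=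
  LinearMap.restrict (Ideal.Quotient.mkₐ k J).toLinearMap
    (fun _ hx => D.mk_mem_quotDeg J hx)

/-- The map from `B` to the direct sum of the components of the quotient. -/
def preDecompose (J : Ideal B) [J.IsTwoSided] : B →ₗ[k] ⨁ n, D.quotDeg J n :=
  DirectSum.toModule k ℕ (⨁ n, D.quotDeg J n)
      (fun n => DirectSum.lof k ℕ (fun n => D.quotDeg J n) n ∘ₗ D.quotDegMk J n) ∘ₗ
    (DirectSum.decomposeLinearEquiv D.deg).toLinearMap

theorem preDecompose_of_mem (J : Ideal B) [J.IsTwoSided] {n : ℕ} {x : B} (hx : x ∈ D.deg n) :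
    D.preDecompose J x = DirectSum.of (fun n => D.quotDeg J n) n
      ⟨Ideal.Quotient.mkₐ k J x, D.mk_mem_quotDeg J hx⟩ := by
  simp only [preDecompose, LinearMap.comp_apply, LinearEquiv.coe_coe,
    DirectSum.decomposeLinearEquiv_apply, DirectSum.decompose_of_mem D.deg hx]
  exact DirectSum.toModule_lof k n _

theorem preDecompose_eq_zero (J : Ideal B) [J.IsTwoSided] (hJ : ∀ x ∈ J, ∀ n, D.comp n x ∈ J)
    (x : B) (hx : x ∈ J) : D.preDecompose J x = 0 := by
  classical
  rw [← DirectSum.sum_support_decompose D.deg x, map_sum]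
  refine Finset.sum_eq_zero fun i _ => ?_
  rw [D.preDecompose_of_mem J (SetLike.coe_mem _)]
  have h : (⟨Ideal.Quotient.mkₐ k J (DirectSum.decompose D.deg x i : B),
      D.mk_mem_quotDeg J (SetLike.coe_mem _)⟩ : D.quotDeg J i) = 0 :=
    Subtype.ext (Ideal.Quotient.eq_zero_iff_mem.2 (hJ x hx i))
  rw [h, map_zero]

/-- The quotient by a homogeneous ideal is graded. -/
@[reducible]
def quotDecomposition (J : Ideal B) [J.IsTwoSided] (hJ : ∀ x ∈ J, ∀ n, D.comp n x ∈ J) :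
    DirectSum.Decomposition (D.quotDeg J) :=
  DirectSum.Decomposition.ofLinearMap _
    (quotLift J (D.preDecompose J) (D.preDecompose_eq_zero J hJ))
    (by
      refine LinearMap.ext fun y => ?_
      obtain ⟨x, rfl⟩ := Ideal.Quotient.mkₐ_surjective k J y
      induction x using D.induction_deg with
      | hadd a b ha hb => rw [map_add, map_add, ha, hb, map_add]
      | h n x hx =>
        rw [LinearMap.comp_apply, quotLift_mk, D.preDecompose_of_mem J hx,
          DirectSum.coeLinearMap_of]
        rfl)
    (by
      refine DirectSum.linearMap_ext k fun n => LinearMap.ext fun y => ?_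
      obtain ⟨_, x, hx, rfl⟩ := y
      rw [LinearMap.comp_apply, LinearMap.comp_apply, DirectSum.lof_eq_of,
        DirectSum.coeLinearMap_of]
      refine (quotLift_mk J _ _ x).trans ?_
      rw [D.preDecompose_of_mem J hx]
      rfl)

/-- The differential of the quotient. -/
def quotD (S : Set B) : (B ⧸ D.diffIdeal S) →ₗ[k] (B ⧸ D.diffIdeal S) :=
  quotLift (D.diffIdeal S) ((Ideal.Quotient.mkₐ k (D.diffIdeal S)).toLinearMap ∘ₗ D.d)
    (fun _ hx => Ideal.Quotient.eq_zero_iff_mem.2 (D.d_mem_diffIdeal hx))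

theorem quotD_mk (S : Set B) (x : B) : D.quotD S (Ideal.Quotient.mkₐ k (D.diffIdeal S) x) =
    Ideal.Quotient.mkₐ k (D.diffIdeal S) (D.d x) := rfl

/-- The quotient of a differential graded algebra by the differential ideal generated by a set
of homogeneous elements. -/
def quotient (S : Set B) (hS : ∀ x ∈ S, ∃ n, x ∈ D.deg n) :
    DGStructure k (B ⧸ D.diffIdeal S) where
  deg := D.quotDeg (D.diffIdeal S)
  gr := { D.quotDeg_gradedMonoid (D.diffIdeal S),
          D.quotDecomposition (D.diffIdeal S) (fun _ hx n => D.comp_mem_diffIdeal hS hx n) with }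
  d := D.quotD S
  d_mem := by
    rintro n _ ⟨x, hx, rfl⟩
    exact ⟨D.d x, D.d_mem n x hx, rfl⟩
  d_d := by
    intro y
    obtain ⟨x, rfl⟩ := Ideal.Quotient.mkₐ_surjective k _ y
    rw [quotD_mk, quotD_mk, D.d_d, map_zero]
  leibniz := by
    rintro n _ z ⟨x, hx, rfl⟩
    obtain ⟨y, rfl⟩ := Ideal.Quotient.mkₐ_surjective k _ z
    rw [AlgHom.toLinearMap_apply, ← map_mul, quotD_mk, quotD_mk, quotD_mk, D.leibniz n x y hx,
      map_add, map_smul, map_mul, map_mul]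

end DGStructure

end DG

/-! ### Universal differential forms -/

section Universal

variable (k : Type*) [CommRing k] (A : Type*) [CommRing A] [Algebra k A]

/-- The `A`-bimodule `Ω¹ A` of universal one-forms: the kernel of the multiplication map
`A ⊗ A → A`. The left and right actions of `a : A` are the multiplications by `a ⊗ 1` and
`1 ⊗ a`. -/
abbrev OneForms : Type _ := KaehlerDifferential.ideal k A

variable {A} in
/-- The left action of `A` on one-forms. -/
def lsmul (a : A) (m : OneForms k A) : OneForms k A := (a ⊗ₜ[k] (1 : A)) • m

variable {A} in
/-- The right action of `A` on one-forms. -/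
def rsmul (m : OneForms k A) (a : A) : OneForms k A := ((1 : A) ⊗ₜ[k] a) • m

variable {A} in
/-- The universal derivation `a ↦ 1 ⊗ a - a ⊗ 1`. -/
def univD : A →ₗ[k] OneForms k A where
  toFun a := ⟨1 ⊗ₜ[k] a - a ⊗ₜ[k] 1, KaehlerDifferential.one_smul_sub_smul_one_mem_ideal k a⟩
  map_add' a b := Subtype.ext (by
    simp only [TensorProduct.tmul_add, TensorProduct.add_tmul, Submodule.coe_add]; abel)
  map_smul' c a := Subtype.ext (by
    simp [TensorProduct.tmul_smul, TensorProduct.smul_tmul', smul_sub])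

/-- The relations that turn the tensor algebra over `k` of `A × Ω¹ A` into the tensor algebra of
the `A`-bimodule `Ω¹ A`. -/
inductive Rel : TensorAlgebra k (A × OneForms k A) → TensorAlgebra k (A × OneForms k A) → Prop
  | one : Rel (TensorAlgebra.ι k (1, 0)) 1
  | mul (a b : A) :
      Rel (TensorAlgebra.ι k (a, 0) * TensorAlgebra.ι k (b, 0)) (TensorAlgebra.ι k (a * b, 0))
  | left (a : A) (m : OneForms k A) :
      Rel (TensorAlgebra.ι k (a, 0) * TensorAlgebra.ι k (0, m)) (TensorAlgebra.ι k (0, lsmul k a m))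
  | right (m : OneForms k A) (a : A) :
      Rel (TensorAlgebra.ι k (0, m) * TensorAlgebra.ι k (a, 0)) (TensorAlgebra.ι k (0, rsmul k m a))

/-- The algebra `Ω A` of universal differential forms on `A`: the tensor algebra of the
`A`-bimodule `Ω¹ A`. -/
def Univ : Type _ := RingQuot (Rel k A)

instance : Ring (Univ k A) := inferInstanceAs (Ring (RingQuot (Rel k A)))

instance : Algebra k (Univ k A) := inferInstanceAs (Algebra k (RingQuot (Rel k A)))

namespace Univ

/-- The quotient map from the tensor algebra over `k`. -/
def mk : TensorAlgebra k (A × OneForms k A) →ₐ[k] Univ k A := RingQuot.mkAlgHom k (Rel k A)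

theorem mk_rel {x y : TensorAlgebra k (A × OneForms k A)} (h : Rel k A x y) :
    mk k A x = mk k A y := RingQuot.mkAlgHom_rel k h

/-- Functions on `A`, as forms of degree zero. -/
def inA : A →ₐ[k] Univ k A :=
  AlgHom.ofLinearMap ((mk k A).toLinearMap ∘ₗ TensorAlgebra.ι k ∘ₗ LinearMap.inl k A _)
    (by simpa using mk_rel k A Rel.one)
    (fun a b => by simpa using (mk_rel k A (Rel.mul a b)).symm)

/-- One-forms, as elements of the algebra of universal forms. -/
def inΩ : OneForms k A →ₗ[k] Univ k A :=
  (mk k A).toLinearMap ∘ₗ TensorAlgebra.ι k ∘ₗ LinearMap.inr k A _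

variable {A}

theorem inΩ_lsmul (a : A) (m : OneForms k A) : inΩ k A (lsmul k a m) = inA k A a * inΩ k A m :=
  ((map_mul (mk k A) _ _).symm.trans (mk_rel k A (Rel.left a m))).symm

theorem inΩ_rsmul (m : OneForms k A) (a : A) : inΩ k A (rsmul k m a) = inΩ k A m * inA k A a :=
  ((map_mul (mk k A) _ _).symm.trans (mk_rel k A (Rel.right m a))).symm

variable {k}

/-- The universal property of the tensor algebra of a bimodule. -/
def lift {C : Type*} [Semiring C] [Algebra k C] (f : A →ₐ[k] C) (g : OneForms k A →ₗ[k] C)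
    (hl : ∀ a m, g (lsmul k a m) = f a * g m) (hr : ∀ m a, g (rsmul k m a) = g m * f a) :
    Univ k A →ₐ[k] C :=
  RingQuot.liftAlgHom k ⟨TensorAlgebra.lift k (f.toLinearMap.coprod g), by
    intro x y h
    induction h with
    | one => simp
    | mul a b => simp
    | left a m => simp [hl]
    | right m a => simp [hr]⟩

section

variable {C : Type*} [Semiring C] [Algebra k C] (f : A →ₐ[k] C) (g : OneForms k A →ₗ[k] C)
    (hl : ∀ a m, g (lsmul k a m) = f a * g m) (hr : ∀ m a, g (rsmul k m a) = g m * f a)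

@[simp] theorem lift_inA (a : A) : lift f g hl hr (inA k A a) = f a := by
  have : lift f g hl hr (mk k A (TensorAlgebra.ι k (a, 0))) = f a := by
    unfold lift mk
    erw [RingQuot.liftAlgHom_mkAlgHom_apply]
    simp
  exact this

@[simp] theorem lift_inΩ (m : OneForms k A) : lift f g hl hr (inΩ k A m) = g m := by
  have : lift f g hl hr (mk k A (TensorAlgebra.ι k (0, m))) = g m := by
    unfold lift mk
    erw [RingQuot.liftAlgHom_mkAlgHom_apply]
    simp
  exact this

end

theorem hom_ext {C : Type*} [Semiring C] [Algebra k C] {f g : Univ k A →ₐ[k] C}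
    (h0 : ∀ a, f (inA k A a) = g (inA k A a)) (h1 : ∀ m, f (inΩ k A m) = g (inΩ k A m)) :
    f = g := by
  refine RingQuot.ringQuot_ext' k f g ?_
  refine TensorAlgebra.hom_ext (LinearMap.ext fun x => ?_)
  obtain ⟨a, m⟩ := x
  have hx : ((a, m) : A × OneForms k A) = (a, 0) + (0, m) := by simp
  rw [hx, map_add, map_add]
  exact congrArg₂ (· + ·) (h0 a) (h1 m)

/-! #### The grading -/

variable (k A)

/-- The forms of degree `n`: the span of the products `a m₁ ⋯ mₙ` with `a` in `A` and
`m₁, …, mₙ` in `Ω¹ A`. -/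
def deg (n : ℕ) : Submodule k (Univ k A) :=
  LinearMap.range (inA k A).toLinearMap * LinearMap.range (inΩ k A) ^ n

theorem inA_mem (a : A) : inA k A a ∈ deg k A 0 := by
  rw [deg, pow_zero, mul_one]; exact ⟨a, rfl⟩

theorem inΩ_mem (m : OneForms k A) : inΩ k A m ∈ deg k A 1 := by
  rw [deg, pow_one, ← one_mul (inΩ k A m)]
  exact Submodule.mul_mem_mul ⟨1, map_one (inA k A)⟩ ⟨m, rfl⟩

theorem range_mul_range : LinearMap.range (inA k A).toLinearMap *
    LinearMap.range (inA k A).toLinearMap ≤ LinearMap.range (inA k A).toLinearMap := by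
  rw [Submodule.mul_le]
  rintro _ ⟨a, rfl⟩ _ ⟨b, rfl⟩
  exact ⟨a * b, map_mul (inA k A) a b⟩

theorem range_pow_mul_range (n : ℕ) : LinearMap.range (inΩ k A) ^ n *
    LinearMap.range (inA k A).toLinearMap ≤
      LinearMap.range (inA k A).toLinearMap * LinearMap.range (inΩ k A) ^ n := by
  have h1 : (1 : Submodule k (Univ k A)) ≤ LinearMap.range (inA k A).toLinearMap := by
    rw [Submodule.one_le]; exact ⟨1, map_one (inA k A)⟩
  cases n with
  | zero => simp
  | succ n =>
    have h2 : LinearMap.range (inΩ k A) * LinearMap.range (inA k A).toLinearMap ≤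
        LinearMap.range (inΩ k A) := by
      rw [Submodule.mul_le]
      rintro _ ⟨m, rfl⟩ _ ⟨a, rfl⟩
      exact ⟨rsmul k m a, inΩ_rsmul k m a⟩
    calc _ = LinearMap.range (inΩ k A) ^ n *
          (LinearMap.range (inΩ k A) * LinearMap.range (inA k A).toLinearMap) := by
            rw [pow_succ, mul_assoc]
      _ ≤ LinearMap.range (inΩ k A) ^ n * LinearMap.range (inΩ k A) := by gcongr
      _ = 1 * LinearMap.range (inΩ k A) ^ (n + 1) := by rw [one_mul, pow_succ]
      _ ≤ _ := by gcongr

instance deg_gradedMonoid : SetLike.GradedMonoid (deg k A) where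
  one_mem := by rw [← map_one (inA k A)]; exact inA_mem k A 1
  mul_mem := by
    intro i j x y hx hy
    have h : deg k A i * deg k A j ≤ deg k A (i + j) := by
      unfold deg
      calc _ = LinearMap.range (inA k A).toLinearMap * (LinearMap.range (inΩ k A) ^ i *
            LinearMap.range (inA k A).toLinearMap) * LinearMap.range (inΩ k A) ^ j := by
              simp only [mul_assoc]
        _ ≤ LinearMap.range (inA k A).toLinearMap * (LinearMap.range (inA k A).toLinearMap *
            LinearMap.range (inΩ k A) ^ i) * LinearMap.range (inΩ k A) ^ j := by
              exact mul_le_mul_left (mul_le_mul_right (range_pow_mul_range k A i) _) _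
        _ = (LinearMap.range (inA k A).toLinearMap * LinearMap.range (inA k A).toLinearMap) *
            LinearMap.range (inΩ k A) ^ (i + j) := by simp only [mul_assoc, pow_add]
        _ ≤ _ := by gcongr; exact range_mul_range k A
    exact h (Submodule.mul_mem_mul hx hy)

/-- Functions, as elements of the direct sum of the homogeneous components. -/
def dsA : A →ₐ[k] ⨁ n, deg k A n :=
  AlgHom.ofLinearMap
    { toFun := fun a => DirectSum.of (fun n => deg k A n) 0 ⟨inA k A a, inA_mem k A a⟩
      map_add' := fun a b => by
        rw [← map_add]; congr 1; exact Subtype.ext (map_add (inA k A) a b)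
      map_smul' := fun c a => by
        rw [← DirectSum.lof_eq_of k, ← DirectSum.lof_eq_of k, RingHom.id_apply, ← map_smul]
        congr 1; exact Subtype.ext (map_smul (inA k A) c a) }
    (DirectSum.of_eq_of_gradedMonoid_eq (Sigma.subtype_ext rfl (map_one (inA k A))))
    (fun a b => by
      simp only [LinearMap.coe_mk, AddHom.coe_mk, DirectSum.of_mul_of]
      exact DirectSum.of_eq_of_gradedMonoid_eq (Sigma.subtype_ext rfl (map_mul (inA k A) a b)))

theorem dsA_apply (a : A) : dsA k A a =
    DirectSum.of (fun n => deg k A n) 0 ⟨inA k A a, inA_mem k A a⟩ := rfl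

/-- One-forms, as elements of the direct sum of the homogeneous components. -/
def dsΩ : OneForms k A →ₗ[k] ⨁ n, deg k A n where
  toFun m := DirectSum.of (fun n => deg k A n) 1 ⟨inΩ k A m, inΩ_mem k A m⟩
  map_add' a b := by
    rw [← map_add]; congr 1; exact Subtype.ext (map_add (inΩ k A) a b)
  map_smul' c a := by
    rw [← DirectSum.lof_eq_of k, ← DirectSum.lof_eq_of k, RingHom.id_apply, ← map_smul]
    congr 1; exact Subtype.ext (map_smul (inΩ k A) c a)

theorem dsΩ_apply (m : OneForms k A) : dsΩ k A m =
    DirectSum.of (fun n => deg k A n) 1 ⟨inΩ k A m, inΩ_mem k A m⟩ := rfl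

/-- The algebra map to the direct sum of the homogeneous components. -/
def toDirectSum : Univ k A →ₐ[k] ⨁ n, deg k A n :=
  lift (dsA k A) (dsΩ k A)
    (fun a m => by
      rw [dsA_apply, dsΩ_apply, dsΩ_apply, DirectSum.of_mul_of]
      exact DirectSum.of_eq_of_gradedMonoid_eq (Sigma.subtype_ext rfl (inΩ_lsmul k a m)))
    (fun m a => by
      rw [dsA_apply, dsΩ_apply, dsΩ_apply, DirectSum.of_mul_of]
      exact DirectSum.of_eq_of_gradedMonoid_eq (Sigma.subtype_ext rfl (inΩ_rsmul k m a)))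

theorem toDirectSum_inA (a : A) : toDirectSum k A (inA k A a) =
    DirectSum.of (fun n => deg k A n) 0 ⟨inA k A a, inA_mem k A a⟩ :=
  lift_inA _ _ _ _ a

theorem toDirectSum_inΩ (m : OneForms k A) : toDirectSum k A (inΩ k A m) =
    DirectSum.of (fun n => deg k A n) 1 ⟨inΩ k A m, inΩ_mem k A m⟩ :=
  lift_inΩ _ _ _ _ m

theorem deg_induction {P : ∀ n, ∀ x ∈ deg k A n, Prop}
    (add : ∀ n x y hx hy, P n x hx → P n y hy → P n (x + y) (add_mem hx hy))
    (zero : ∀ a, P 0 (inA k A a) (inA_mem k A a))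
    (succ : ∀ n x hx m, P n x hx →
      P (n + 1) (x * inΩ k A m) (SetLike.GradedMul.mul_mem hx (inΩ_mem k A m)))
    {n : ℕ} {x : Univ k A} (hx : x ∈ deg k A n) : P n x hx := by
  induction n generalizing x with
  | zero =>
    obtain ⟨a, rfl⟩ : ∃ a, inA k A a = x := by
      rw [deg, pow_zero, mul_one] at hx; exact hx
    exact zero a
  | succ n ih =>
    have hx' : x ∈ deg k A n * LinearMap.range (inΩ k A) := by
      rw [deg, mul_assoc, ← pow_succ]; exact hx
    have : ∃ h : x ∈ deg k A (n + 1), P (n + 1) x h := by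
      induction hx' using Submodule.mul_induction_on' with
      | mem_mul_mem y hy z hz =>
        obtain ⟨m, rfl⟩ := hz
        exact ⟨_, succ n y hy m (ih hy)⟩
      | add y hy z hz h1 h2 =>
        have hle : deg k A n * LinearMap.range (inΩ k A) ≤ deg k A (n + 1) := by
          rw [deg, deg, mul_assoc, ← pow_succ]
        obtain ⟨h1, p1⟩ := h1 (hle hy)
        obtain ⟨h2, p2⟩ := h2 (hle hz)
        exact ⟨_, add _ _ _ h1 h2 p1 p2⟩
    exact this.2

instance gradedAlgebra : GradedAlgebra (deg k A) :=
  GradedAlgebra.ofAlgHom _ (toDirectSum k A)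
    (hom_ext (fun a => by simp [toDirectSum_inA]) (fun m => by simp [toDirectSum_inΩ]))
    (by
      rintro n ⟨x, hx⟩
      induction hx using deg_induction with
      | add n x y hx hy h1 h2 =>
        simp only at h1 h2 ⊢
        rw [map_add, h1, h2, ← map_add]; rfl
      | zero a => exact toDirectSum_inA k A a
      | succ n x hx m h =>
        simp only at h ⊢
        rw [map_mul, h, toDirectSum_inΩ, DirectSum.of_mul_of]
        rfl)

/-! #### The differential -/

/-- The map `a ⊗ b ↦ da db`. -/
def dd : A ⊗[k] A →ₗ[k] Univ k A :=
  TensorProduct.lift ((LinearMap.mul k (Univ k A)).compl₁₂ (inΩ k A ∘ₗ univD k)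
    (inΩ k A ∘ₗ univD k))

/-- The differential on `Ω¹ A`: the element `∑ aᵢ ⊗ bᵢ` of `Ω¹ A` is the one-form `∑ aᵢ dbᵢ`, and
its differential is `∑ daᵢ dbᵢ`. -/
def dΩ : OneForms k A →ₗ[k] Univ k A :=
  dd k A ∘ₗ ((KaehlerDifferential.ideal k A).restrictScalars k).subtype

theorem dΩ_apply (m : OneForms k A) : dΩ k A m = dd k A (m : A ⊗[k] A) := rfl

variable {A}

@[simp] theorem dd_tmul (a b : A) :
    dd k A (a ⊗ₜ[k] b) = inΩ k A (univD k a) * inΩ k A (univD k b) := by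
  simp [dd]

theorem coe_univD (a : A) :
    (univD k a : A ⊗[k] A) = (1 : A) ⊗ₜ[k] a - a ⊗ₜ[k] (1 : A) := rfl

theorem univD_mul (a b : A) : univD k (a * b) = rsmul k (univD k a) b + lsmul k a (univD k b) := by
  refine Subtype.ext ?_
  simp only [rsmul, lsmul, Submodule.coe_add, Submodule.coe_smul, coe_univD, smul_eq_mul, mul_sub,
    Algebra.TensorProduct.tmul_mul_tmul, one_mul, mul_one]
  rw [mul_comm b a]; abel

theorem univD_one : univD k (1 : A) = 0 := Subtype.ext (by simp [coe_univD])

theorem inΩ_univD_mul (a b : A) : inΩ k A (univD k (a * b)) =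
    inΩ k A (univD k a) * inA k A b + inA k A a * inΩ k A (univD k b) := by
  rw [univD_mul, map_add, inΩ_lsmul, inΩ_rsmul]

variable (A)

/-- The map `a ⊗ b ↦ a db` with values in one-forms. -/
def hh : A ⊗[k] A →ₗ[k] Univ k A :=
  TensorProduct.lift ((LinearMap.mul k (Univ k A)).compl₁₂ (inA k A).toLinearMap
    (inΩ k A ∘ₗ univD k))

variable {A}

theorem hh_eq (m : OneForms k A) : hh k A (m : A ⊗[k] A) = inΩ k A m := by
  have key : ∀ t : A ⊗[k] A, ∃ h : t - (Algebra.TensorProduct.lmul' k (S := A) t) ⊗ₜ[k] (1 : A) ∈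
      KaehlerDifferential.ideal k A, hh k A t = inΩ k A ⟨_, h⟩ := by
    intro t
    have h : t - (Algebra.TensorProduct.lmul' k (S := A) t) ⊗ₜ[k] (1 : A) ∈
        KaehlerDifferential.ideal k A := by
      rw [KaehlerDifferential.ideal, RingHom.mem_ker]; simp
    refine ⟨h, ?_⟩
    induction t using TensorProduct.induction_on with
    | zero =>
      rw [map_zero, ← map_zero (inΩ k A)]; congr 1; exact Subtype.ext (by simp)
    | tmul x y =>
      have : hh k A (x ⊗ₜ[k] y) = inA k A x * inΩ k A (univD k y) := by simp [hh]
      rw [this, ← inΩ_lsmul]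
      congr 1
      refine Subtype.ext ?_
      simp [lsmul, coe_univD, mul_sub]
    | add x y hx hy =>
      have h1 : x - (Algebra.TensorProduct.lmul' k (S := A) x) ⊗ₜ[k] (1 : A) ∈
        KaehlerDifferential.ideal k A := by
        rw [KaehlerDifferential.ideal, RingHom.mem_ker]; simp
      have h2 : y - (Algebra.TensorProduct.lmul' k (S := A) y) ⊗ₜ[k] (1 : A) ∈
        KaehlerDifferential.ideal k A := by
        rw [KaehlerDifferential.ideal, RingHom.mem_ker]; simp
      rw [map_add, hx h1, hy h2, ← map_add]
      congr 1
      refine Subtype.ext ?_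
      simp only [Submodule.coe_add, map_add, TensorProduct.add_tmul]
      abel
  obtain ⟨h, e⟩ := key m
  rw [e]
  congr 1
  refine Subtype.ext ?_
  have hm : Algebra.TensorProduct.lmul' k (S := A) (m : A ⊗[k] A) = 0 :=
    RingHom.mem_ker.1 m.2
  simp [hm]

theorem dΩ_lsmul (a : A) (m : OneForms k A) : dΩ k A (lsmul k a m) =
    inΩ k A (univD k a) * inΩ k A m + inA k A a * dΩ k A m := by
  have key : ∀ t : A ⊗[k] A, dd k A ((a ⊗ₜ[k] (1 : A)) * t) =
      inΩ k A (univD k a) * hh k A t + inA k A a * dd k A t := by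
    intro t
    induction t using TensorProduct.induction_on with
    | zero => simp
    | tmul x y => simp [hh, inΩ_univD_mul, add_mul, mul_assoc]
    | add x y hx hy => rw [mul_add, map_add, hx, hy, map_add, map_add]; noncomm_ring
  have h := key m
  rw [hh_eq] at h
  exact h

theorem dΩ_rsmul (m : OneForms k A) (a : A) : dΩ k A (rsmul k m a) =
    dΩ k A m * inA k A a - inΩ k A m * inΩ k A (univD k a) := by
  have key : ∀ t : A ⊗[k] A, dd k A (((1 : A) ⊗ₜ[k] a) * t) = dd k A t * inA k A a +
      (inΩ k A (univD k (Algebra.TensorProduct.lmul' k (S := A) t)) - hh k A t) *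
        inΩ k A (univD k a) := by
    intro t
    induction t using TensorProduct.induction_on with
    | zero => simp
    | tmul x y =>
      simp [hh, mul_comm a y, inΩ_univD_mul, mul_add, mul_assoc]
    | add x y hx hy => rw [mul_add, map_add, hx, hy]; simp only [map_add]; noncomm_ring
  have h := key m
  have hm : Algebra.TensorProduct.lmul' k (S := A) (m : A ⊗[k] A) = 0 :=
    RingHom.mem_ker.1 m.2
  rw [hh_eq, hm, map_zero, map_zero, zero_sub, neg_mul, ← sub_eq_add_neg] at h
  exact h

variable (A)

/-- The matrix of a function. -/
def matA : A →ₐ[k] Matrix (Fin 2) (Fin 2) (Univ k A) :=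
  AlgHom.ofLinearMap
    { toFun := fun a => !![inA k A a, inΩ k A (univD k a); 0, inA k A a]
      map_add' := fun a b => by
        ext i j; fin_cases i <;> fin_cases j <;> simp
      map_smul' := fun c a => by
        ext i j; fin_cases i <;> fin_cases j <;> simp }
    (by ext i j; fin_cases i <;> fin_cases j <;> simp [univD_one])
    (fun a b => by
      ext i j; fin_cases i <;> fin_cases j <;>
        simp [Matrix.mul_apply, Fin.sum_univ_two, inΩ_univD_mul, add_comm])

/-- The matrix of a one-form. -/
def matΩ : OneForms k A →ₗ[k] Matrix (Fin 2) (Fin 2) (Univ k A) where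
  toFun m := !![-inΩ k A m, dΩ k A m; 0, inΩ k A m]
  map_add' a b := by
    ext i j; fin_cases i <;> fin_cases j <;> simp [add_comm]
  map_smul' c a := by
    ext i j; fin_cases i <;> fin_cases j <;> simp

theorem matA_apply (a : A) : matA k A a = !![inA k A a, inΩ k A (univD k a); 0, inA k A a] := rfl

theorem matΩ_apply (m : OneForms k A) :
    matΩ k A m = !![-inΩ k A m, dΩ k A m; 0, inΩ k A m] := rfl

/-- The algebra map that sends a form `x` of degree `n` to the upper triangular matrix with
diagonal `(-1) ^ n x`, `x` and with `d x` in the corner; it is used to extend `d` from `A` and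
`Ω¹ A` as a graded derivation. -/
def mat : Univ k A →ₐ[k] Matrix (Fin 2) (Fin 2) (Univ k A) :=
  lift (matA k A) (matΩ k A)
    (fun a m => by
      rw [matA_apply, matΩ_apply, matΩ_apply]
      ext i j; fin_cases i <;> fin_cases j <;>
        simp [Matrix.mul_apply, Fin.sum_univ_two, inΩ_lsmul, dΩ_lsmul, add_comm])
    (fun m a => by
      rw [matA_apply, matΩ_apply, matΩ_apply]
      ext i j; fin_cases i <;> fin_cases j <;>
        simp [Matrix.mul_apply, Fin.sum_univ_two, inΩ_rsmul, dΩ_rsmul, sub_eq_neg_add])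

/-- The differential of universal forms. -/
def d : Univ k A →ₗ[k] Univ k A := Matrix.entryLinearMap k (Univ k A) 0 1 ∘ₗ (mat k A).toLinearMap

variable {A}

theorem d_apply (x : Univ k A) : d k A x = mat k A x 0 1 := rfl

theorem d_inA (a : A) : d k A (inA k A a) = inΩ k A (univD k a) := by
  rw [d_apply, mat, lift_inA, matA_apply]; rfl

theorem d_inΩ (m : OneForms k A) : d k A (inΩ k A m) = dΩ k A m := by
  rw [d_apply, mat, lift_inΩ, matΩ_apply]; rfl

theorem mat_of_mem {n : ℕ} {x : Univ k A} (hx : x ∈ deg k A n) :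
    mat k A x = !![(-1 : k) ^ n • x, d k A x; 0, x] := by
  induction hx using deg_induction with
  | add n x y hx hy h1 h2 =>
    rw [map_add, h1, h2]
    ext i j; fin_cases i <;> fin_cases j <;> simp
  | zero a =>
    rw [d_inA, mat, lift_inA, matA_apply]; simp
  | succ n x hx m h =>
    have hm : mat k A (inΩ k A m) = !![-inΩ k A m, dΩ k A m; 0, inΩ k A m] := lift_inΩ _ _ _ _ m
    have h3 := map_mul (mat k A) x (inΩ k A m)
    rw [h, hm] at h3
    rw [d_apply, h3]
    ext i j; fin_cases i <;> fin_cases j <;> simp [Matrix.mul_apply, Fin.sum_univ_two, pow_succ]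

theorem mat_11 (x : Univ k A) : mat k A x 1 1 = x := by
  induction x using DirectSum.Decomposition.inductionOn (deg k A) with
  | zero => simp
  | homogeneous x => rw [mat_of_mem k x.2]; rfl
  | add x y hx hy => rw [map_add, Matrix.add_apply, hx, hy]

theorem d_mul {n : ℕ} {x : Univ k A} (hx : x ∈ deg k A n) (y : Univ k A) :
    d k A (x * y) = d k A x * y + (-1 : k) ^ n • (x * d k A y) := by
  rw [d_apply, map_mul, mat_of_mem k hx, Matrix.mul_apply, Fin.sum_univ_two, mat_11, ← d_apply]
  simp [add_comm]

theorem dΩ_mem (m : OneForms k A) : dΩ k A m ∈ deg k A 2 := by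
  rw [dΩ_apply]
  induction (m : A ⊗[k] A) using TensorProduct.induction_on with
  | zero => rw [map_zero]; exact zero_mem _
  | tmul a b =>
    rw [dd_tmul]
    exact SetLike.mul_mem_graded (i := 1) (j := 1) (inΩ_mem k A _) (inΩ_mem k A _)
  | add x y hx hy => rw [map_add]; exact add_mem hx hy

theorem d_mem {n : ℕ} {x : Univ k A} (hx : x ∈ deg k A n) : d k A x ∈ deg k A (n + 1) := by
  induction hx using deg_induction with
  | add n x y hx hy h1 h2 => rw [map_add]; exact add_mem h1 h2
  | zero a => rw [d_inA]; exact inΩ_mem k A _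
  | succ n x hx m h =>
    rw [d_mul k hx, d_inΩ]
    exact add_mem (SetLike.mul_mem_graded (i := n + 1) (j := 1) h (inΩ_mem k A m))
      (Submodule.smul_mem _ _ (SetLike.mul_mem_graded (i := n) (j := 2) hx (dΩ_mem k m)))

theorem dΩ_univD (a : A) : dΩ k A (univD k a) = 0 := by
  rw [dΩ_apply, coe_univD, map_sub, dd_tmul, dd_tmul, univD_one, map_zero, zero_mul, mul_zero,
    sub_zero]

theorem d_dΩ (m : OneForms k A) : d k A (dΩ k A m) = 0 := by
  rw [dΩ_apply]
  induction (m : A ⊗[k] A) using TensorProduct.induction_on with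
  | zero => rw [map_zero, map_zero]
  | tmul a b =>
    rw [dd_tmul, d_mul k (inΩ_mem k A _), d_inΩ, d_inΩ, dΩ_univD, dΩ_univD, zero_mul, mul_zero,
      smul_zero, add_zero]
  | add x y hx hy => rw [map_add, map_add, hx, hy, add_zero]

theorem d_d (x : Univ k A) : d k A (d k A x) = 0 := by
  induction x using DirectSum.Decomposition.inductionOn (deg k A) with
  | zero => simp
  | add x y hx hy => rw [map_add, map_add, hx, hy, add_zero]
  | @homogeneous n x =>
    obtain ⟨x, hx⟩ := x
    simp only
    induction hx using deg_induction with
    | add n x y hx hy h1 h2 => rw [map_add, map_add, h1, h2, add_zero]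
    | zero a => rw [d_inA, d_inΩ, dΩ_univD]
    | succ n x hx m h =>
      rw [d_mul k hx, map_add, map_smul, d_mul k (d_mem k hx), d_mul k hx, d_inΩ, d_dΩ, h]
      simp [pow_succ]

end Univ

/-- The differential graded algebra of universal differential forms. -/
def univDG : DGStructure k (Univ k A) where
  deg := Univ.deg k A
  gr := Univ.gradedAlgebra k A
  d := Univ.d k A
  d_mem _ _ hx := Univ.d_mem k hx
  d_d := Univ.d_d k
  leibniz _ _ y hx := Univ.d_mul k hx y

end Universal

/-! ### Functoriality of universal forms -/

section Functor

variable {k : Type*} [CommRing k] {A : Type*} [CommRing A] [Algebra k A]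
  {B : Type*} [CommRing B] [Algebra k B]

/-- The map induced on universal one-forms by a morphism of algebras. -/
def OneForms.map (f : A →ₐ[k] B) : OneForms k A →ₗ[k] OneForms k B where
  toFun m := ⟨Algebra.TensorProduct.map f f (m : A ⊗[k] A), by
    have hm : Algebra.TensorProduct.lmul' k (S := A) (m : A ⊗[k] A) = 0 := RingHom.mem_ker.1 m.2
    refine RingHom.mem_ker.2 ?_
    have key : ∀ t : A ⊗[k] A, Algebra.TensorProduct.lmul' k (S := B)
        (Algebra.TensorProduct.map f f t) = f (Algebra.TensorProduct.lmul' k (S := A) t) := by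
      intro t
      induction t using TensorProduct.induction_on with
      | zero => simp
      | tmul a b => simp
      | add x y hx hy => simp only [map_add, hx, hy]
    exact (key m).trans ((congrArg f hm).trans (map_zero f))⟩
  map_add' a b := Subtype.ext (by simp)
  map_smul' c a := Subtype.ext (map_smul (Algebra.TensorProduct.map f f) c (a : A ⊗[k] A))

theorem OneForms.coe_map (f : A →ₐ[k] B) (m : OneForms k A) :
    (OneForms.map f m : B ⊗[k] B) = Algebra.TensorProduct.map f f (m : A ⊗[k] A) := rfl

theorem OneForms.map_univD (f : A →ₐ[k] B) (a : A) :
    OneForms.map f (univD k a) = univD k (f a) :=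
  Subtype.ext (by simp [OneForms.coe_map, Univ.coe_univD])

/-- The map induced on universal forms by a morphism of algebras. -/
def Univ.map (f : A →ₐ[k] B) : Univ k A →ₐ[k] Univ k B :=
  Univ.lift ((Univ.inA k B).comp f) (Univ.inΩ k B ∘ₗ OneForms.map f)
    (fun a m => by
      have : OneForms.map f (lsmul k a m) = lsmul k (f a) (OneForms.map f m) :=
        Subtype.ext (by simp [OneForms.coe_map, lsmul])
      rw [LinearMap.comp_apply, this, Univ.inΩ_lsmul]; rfl)
    (fun m a => by
      have : OneForms.map f (rsmul k m a) = rsmul k (OneForms.map f m) (f a) :=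
        Subtype.ext (by simp [OneForms.coe_map, rsmul])
      rw [LinearMap.comp_apply, this, Univ.inΩ_rsmul]; rfl)

@[simp] theorem Univ.map_inA (f : A →ₐ[k] B) (a : A) :
    Univ.map f (Univ.inA k A a) = Univ.inA k B (f a) := Univ.lift_inA _ _ _ _ a

@[simp] theorem Univ.map_inΩ (f : A →ₐ[k] B) (m : OneForms k A) :
    Univ.map f (Univ.inΩ k A m) = Univ.inΩ k B (OneForms.map f m) := Univ.lift_inΩ _ _ _ _ m

theorem Univ.map_mem (f : A →ₐ[k] B) {n : ℕ} {x : Univ k A} (hx : x ∈ Univ.deg k A n) :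
    Univ.map f x ∈ Univ.deg k B n := by
  induction hx using Univ.deg_induction with
  | add n x y hx hy h1 h2 => rw [map_add]; exact add_mem h1 h2
  | zero a => rw [Univ.map_inA]; exact Univ.inA_mem k B _
  | succ n x hx m h =>
    rw [map_mul, Univ.map_inΩ]; exact SetLike.GradedMul.mul_mem h (Univ.inΩ_mem k B _)

theorem Univ.map_d (f : A →ₐ[k] B) (x : Univ k A) :
    Univ.map f (Univ.d k A x) = Univ.d k B (Univ.map f x) := by
  induction x using DirectSum.Decomposition.inductionOn (Univ.deg k A) with
  | zero => simp
  | add x y hx hy => simp only [map_add, hx, hy]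
  | @homogeneous n x =>
    obtain ⟨x, hx⟩ := x
    simp only
    induction hx using Univ.deg_induction with
    | add n x y hx hy h1 h2 => simp only [map_add, h1, h2]
    | zero a => rw [Univ.d_inA, Univ.map_inΩ, Univ.map_inA, Univ.d_inA, OneForms.map_univD]
    | succ n x hx m h =>
      have hm : ∀ t : A ⊗[k] A, Univ.map f (Univ.dd k A t) =
          Univ.dd k B (Algebra.TensorProduct.map f f t) := by
        intro t
        induction t using TensorProduct.induction_on with
        | zero => simp
        | tmul a b => simp [OneForms.map_univD]
        | add x y hx hy => simp only [map_add, hx, hy]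
      rw [Univ.d_mul k hx, map_mul, Univ.d_mul k (Univ.map_mem f hx), map_add, map_smul, map_mul,
        map_mul, h, Univ.d_inΩ, Univ.map_inΩ, Univ.d_inΩ, Univ.dΩ_apply, Univ.dΩ_apply, hm]
      rfl

end Functor

/-! ### Twisted Kähler differential forms -/

section Twisted

variable {k : Type*} [CommRing k] {A : Type*} [CommRing A] [Algebra k A]
  {B : Type*} [CommRing B] [Algebra k B]

/-- The elements `da b - α(b) da` of `Ω A`. -/
def twistRel (α : A →ₐ[k] A) : Set (Univ k A) :=
  {x | ∃ a b : A, x = Univ.d k A (Univ.inA k A a) * Univ.inA k A b -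
    Univ.inA k A (α b) * Univ.d k A (Univ.inA k A a)}

/-- The algebra `Ω_α A` of twisted Kähler differential forms. -/
abbrev Twisted (α : A →ₐ[k] A) : Type _ := Univ k A ⧸ (univDG k A).diffIdeal (twistRel α)

theorem twistRel_homogeneous (α : A →ₐ[k] A) (x : Univ k A) (hx : x ∈ twistRel α) :
    ∃ n, x ∈ (univDG k A).deg n := by
  obtain ⟨a, b, rfl⟩ := hx
  have h1 : Univ.d k A (Univ.inA k A a) ∈ Univ.deg k A 1 := Univ.d_mem k (Univ.inA_mem k A a)
  have h2 := SetLike.mul_mem_graded (i := 1) (j := 0) h1 (Univ.inA_mem k A b)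
  have h3 := SetLike.mul_mem_graded (i := 0) (j := 1) (Univ.inA_mem k A (α b)) h1
  have h4 : _ ∈ Univ.deg k A 1 := sub_mem h2 h3
  exact ⟨1, h4⟩

namespace Twisted

/-- The differential graded algebra of twisted Kähler differential forms on `(A, α)`. -/
def dg (α : A →ₐ[k] A) : DGStructure k (Twisted α) :=
  (univDG k A).quotient (twistRel α) (twistRel_homogeneous α)

/-- Functions on `A`, as twisted forms of degree zero. -/
def ofA (α : A →ₐ[k] A) : A →ₐ[k] Twisted α :=
  (Ideal.Quotient.mkₐ k _).comp (Univ.inA k A)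

/-- The form `du₁ ⋯ duₙ` for a list `u₁, …, uₙ` of functions. -/
def dprod (α : A →ₐ[k] A) (l : List A) : Twisted α := (l.map fun u => (dg α).d (ofA α u)).prod

/-- The map `Ω_α A → Ω_β B` induced by a morphism `f : (A, α) → (B, β)`, that is, a morphism of
algebras `f : A → B` with `f ∘ α = β ∘ f`. -/
def map {α : A →ₐ[k] A} {β : B →ₐ[k] B} (f : A →ₐ[k] B) (hf : f.comp α = β.comp f) :
    Twisted α →ₐ[k] Twisted β :=
  Ideal.Quotient.liftₐ _ ((Ideal.Quotient.mkₐ k _).comp (Univ.map f)) (by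
    intro x hx
    have h2 : RingHom.ker ((Ideal.Quotient.mkₐ k ((univDG k B).diffIdeal (twistRel β))).comp
        (Univ.map f)) = ((univDG k B).diffIdeal (twistRel β)).comap (Univ.map f) := by
      ext y
      rw [RingHom.mem_ker, Ideal.mem_comap]
      exact Ideal.Quotient.eq_zero_iff_mem
    rw [← RingHom.mem_ker, h2]
    refine ((univDG k A).mem_diffIdeal.1 hx) _ (h2 ▸ inferInstance) ?_ ?_
    · intro y hy
      rw [Ideal.mem_comap] at hy ⊢
      have : Univ.map f ((univDG k A).d y) = (univDG k B).d (Univ.map f y) := Univ.map_d f y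
      rw [this]
      exact (univDG k B).d_mem_diffIdeal hy
    · rintro _ ⟨a, b, rfl⟩
      refine (univDG k B).subset_diffIdeal _ ⟨f a, f b, ?_⟩
      have hb : f (α b) = β (f b) := DFunLike.congr_fun hf b
      rw [map_sub, map_mul, map_mul, Univ.map_d, Univ.map_inA, Univ.map_inA, Univ.map_inA, hb])

/-- The endomorphism of `Ω_α A` induced by `α`. -/
def bar (α : A →ₐ[k] A) : Twisted α →ₐ[k] Twisted α := map α rfl

end Twisted

end Twisted

/-! ### Functorial braidings -/

section Family

/-- A way to assign, to each endomorphism `α : A → A` of a commutative `k`-algebra, a `k`-linear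
endomorphism of `Ω_α A ⊗ Ω_α A`. -/
abbrev Family (k : Type u) [CommRing k] : Type _ :=
  ∀ (A : Type (max u v)) [CommRing A] [Algebra k A] (α : A →ₐ[k] A),
    Twisted α ⊗[k] Twisted α →ₗ[k] Twisted α ⊗[k] Twisted α

/-- A functorial assignment of braidings of the differential graded algebras of twisted forms that
restrict to the ordinary flip in degree zero. -/
structure IsFunctorialBraiding {k : Type u} [CommRing k] (R : Family.{u, v} k) : Prop where
  isDGBraiding : ∀ (A : Type (max u v)) [CommRing A] [Algebra k A] (α : A →ₐ[k] A),
    (Twisted.dg α).IsDGBraiding (R A α)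
  flip : ∀ (A : Type (max u v)) [CommRing A] [Algebra k A] (α : A →ₐ[k] A) (a b : A),
    R A α (Twisted.ofA α a ⊗ₜ[k] Twisted.ofA α b) = Twisted.ofA α b ⊗ₜ[k] Twisted.ofA α a
  natural : ∀ (A B : Type (max u v)) [CommRing A] [Algebra k A] [CommRing B] [Algebra k B]
    (α : A →ₐ[k] A) (β : B →ₐ[k] B) (f : A →ₐ[k] B) (hf : f.comp α = β.comp f),
    TensorProduct.map (Twisted.map f hf).toLinearMap (Twisted.map f hf).toLinearMap ∘ₗ R A α =
      R B β ∘ₗ TensorProduct.map (Twisted.map f hf).toLinearMap (Twisted.map f hf).toLinearMap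

/-- `I` is the `k`-linear map of degree `-1` given by
`I (u₀ du₁ ⋯ duₙ) = ∑ᵢ (-1) ^ (i + 1) u₀ du₁ ⋯ duᵢ₋₁ (uᵢ - α uᵢ) d(α uᵢ₊₁) ⋯ d(α uₙ)`, the sum
over `1 ≤ i ≤ n` (in the code below `i` is counted from `0`). -/
structure IsIntegration {k : Type*} [CommRing k] {A : Type*} [CommRing A] [Algebra k A]
    (α : A →ₐ[k] A) (I : Twisted α →ₗ[k] Twisted α) : Prop where
  map_deg_zero : ∀ x ∈ (Twisted.dg α).deg 0, I x = 0
  map_deg_succ : ∀ n, ∀ x ∈ (Twisted.dg α).deg (n + 1), I x ∈ (Twisted.dg α).deg n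
  formula : ∀ (u₀ : A) (l : List A),
    I (Twisted.ofA α u₀ * Twisted.dprod α l) =
      ∑ i : Fin l.length, (-1 : k) ^ (i : ℕ) •
        (Twisted.ofA α u₀ * Twisted.dprod α (l.take i) * Twisted.ofA α (l.get i - α (l.get i)) *
          Twisted.dprod α ((l.drop (i + 1)).map α))

end Family

end TwistedForms

end

open TwistedForms

/-! Existence. Put `θ x = (-1)^|x| α x` and `K x = I ((-1)^|x| x)`. In `Ω_α A` one has `da x = θ(x)
da` and `a x = x a - K(x) da` for functions `a`, hence by induction on the degree of `ω` the
identity `ω φ = θ^|ω|(φ) ω - K(θ^|ω| φ) dω` (`Twisted.mul_eq_twist`). Reading its products as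
tensors gives `R`, and the identity itself says `μ R = μ`. The other axioms are formal: they use
only that `θ` is an algebra map anticommuting with `d` and `K`, that `K` is a `θ`-derivation with
`K² = 0`, and the homotopy relation `d K - K d = sgn - θ`. `TwistedComm` collects these properties.
The map `I` is the twisted derivation with `I(a) = 0` and `I(da) = a - α a`, realised as the corner
of an algebra map into upper triangular matrices.

Uniqueness. Compatibility with `d` and with products reduces `R` to its values `R(da ⊗ b)`
(`Twisted.eq_braid_of_apply_d_ofA`). Write `N = 1 - α`. By naturality it suffices to treat a
universal pair: the polynomial algebra in the variables `Nⁿx`, `Nⁿy`, enlarged by one variable `t`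
with `α t = 0`. There `da t = α(t) da = 0` and `t` can be cancelled, which forces `R(da ⊗ b)` into
`Ω⁰ ⊗ Ω¹`; and integration `Ω¹ → A` is injective, so nothing is lost by passing to the deviation
`D(a, b)` in `A ⊗ A` of `R(da ⊗ b)` from the expected value.

The relations of `Ω_α A` and the commutativity of `A` give `(Nb' ⊗ 1) D(a, b) = (Nb ⊗ 1) D(a, b')`
and `(1 ⊗ Na') D(a, b) = (1 ⊗ Na) D(a', b)`, and `μ R = μ` gives `μ D = 0`. As `N t = t`, it follows
that `(t ⊗ t) D(x, y) = (Ny ⊗ Nx) D(t, t)`. By naturality `D(t, t)` involves only `t` and `D(x, y)`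
does not involve `t`. Identifying `1 ⊗ t` with `t ⊗ 1` therefore fixes `D(x, y)`, while it kills
`D(t, t)` because `μ D = 0`. What remains is `(t² ⊗ 1) D(x, y) = 0`, so `D(x, y) = 0`. -/

noncomputable section

namespace TwistedForms

/-! ### Braidings from a twisted commutativity -/

section General

variable {k : Type*} [CommRing k] {B : Type*} [Ring B] [Algebra k B]

namespace DGStructure

variable (D : DGStructure k B)

theorem one_mem_deg : (1 : B) ∈ D.deg 0 := SetLike.GradedOne.one_mem

theorem mul_mem_deg {m n : ℕ} {x y : B} (hx : x ∈ D.deg m) (hy : y ∈ D.deg n) :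
    x * y ∈ D.deg (m + n) := SetLike.GradedMul.mul_mem hx hy

theorem linearMap_ext_deg {C : Type*} [AddCommMonoid C] [Module k C] {f g : B →ₗ[k] C}
    (h : ∀ n, ∀ x ∈ D.deg n, f x = g x) : f = g := by
  ext x
  induction x using D.induction_deg with
  | hadd x y hx hy => rw [map_add, map_add, hx, hy]
  | h n x hx => exact h n x hx

theorem sgn_mem {n : ℕ} {x : B} (hx : x ∈ D.deg n) : D.sgn x ∈ D.deg n := by
  rw [D.sgn_of_mem hx]; exact Submodule.smul_mem _ _ hx

theorem sgn_mul (x y : B) : D.sgn (x * y) = D.sgn x * D.sgn y := by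
  induction x using D.induction_deg with
  | hadd x x' h h' => simp only [add_mul, map_add, h, h']
  | h m x hx =>
    induction y using D.induction_deg with
    | hadd y y' h h' => simp only [mul_add, map_add, h, h']
    | h n y hy =>
      rw [D.sgn_of_mem (D.mul_mem_deg hx hy), D.sgn_of_mem hx, D.sgn_of_mem hy, smul_mul_smul_comm,
        pow_add]

theorem sgn_sgn (x : B) : D.sgn (D.sgn x) = x := by
  induction x using D.induction_deg with
  | hadd x x' h h' => simp only [map_add, h, h']
  | h m x hx =>
    rw [D.sgn_of_mem hx, map_smul, D.sgn_of_mem hx, smul_smul, ← pow_add, ← two_mul, pow_mul]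
    simp

theorem d_sgn (x : B) : D.d (D.sgn x) = -D.sgn (D.d x) := by
  induction x using D.induction_deg with
  | hadd x x' h h' => simp only [map_add, h, h', neg_add]
  | h m x hx =>
    rw [D.sgn_of_mem hx, map_smul, D.sgn_of_mem (D.d_mem _ _ hx), pow_succ]
    simp

theorem d_mul (x y : B) : D.d (x * y) = D.d x * y + D.sgn x * D.d y := by
  induction x using D.induction_deg with
  | hadd x x' h h' => simp only [map_add, h, h', add_mul]; abel
  | h m x hx => rw [D.leibniz m x y hx, D.sgn_of_mem hx, smul_mul_assoc]

theorem d_one : D.d 1 = 0 := by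
  have h := D.leibniz 0 1 1 D.one_mem_deg
  simpa using h

/-- The sign map, as a morphism of algebras. -/
def sgnHom : B →ₐ[k] B :=
  AlgHom.ofLinearMap D.sgn (by rw [D.sgn_of_mem D.one_mem_deg]; simp) D.sgn_mul

@[simp] theorem sgnHom_apply (x : B) : D.sgnHom x = D.sgn x := rfl

end DGStructure

/-- A twisted commutativity of a differential graded algebra: an algebra endomorphism `θ` that
anticommutes with the differential, and a `θ`-derivation `K` of degree `-1` that measures the
failure of commutativity. -/
structure TwistedComm (D : DGStructure k B) where
  /-- the twist -/
  θ : B →ₐ[k] B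
  /-- the twisted derivation -/
  K : B →ₗ[k] B
  θ_mem : ∀ n, ∀ x ∈ D.deg n, θ x ∈ D.deg n
  d_θ : ∀ x, D.d (θ x) = -θ (D.d x)
  K_zero : ∀ x ∈ D.deg 0, K x = 0
  K_succ : ∀ n, ∀ x ∈ D.deg (n + 1), K x ∈ D.deg n
  K_mul : ∀ x y, K (x * y) = x * K y + K x * θ y
  θ_K : ∀ x, θ (K x) = -K (θ x)
  K_K : ∀ x, K (K x) = 0
  d_K : ∀ x, D.d (K x) = K (D.d x) + D.sgn x - θ x
  mul_comm : ∀ n, ∀ x ∈ D.deg n, ∀ y, x * y = (θ ^ n) y * x - K ((θ ^ n) y) * D.d x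

namespace TwistedComm

variable {D : DGStructure k B} (T : TwistedComm D)

theorem θ_pow_mem (m : ℕ) {n : ℕ} {x : B} (hx : x ∈ D.deg n) : (T.θ ^ m) x ∈ D.deg n := by
  induction m with
  | zero => simpa using hx
  | succ m ih => rw [pow_succ', AlgHom.mul_apply]; exact T.θ_mem _ _ ih

theorem d_θ_pow (m : ℕ) (x : B) : D.d ((T.θ ^ m) x) = (-1 : k) ^ m • (T.θ ^ m) (D.d x) := by
  induction m with
  | zero => simp
  | succ m ih =>
    rw [pow_succ', AlgHom.mul_apply, AlgHom.mul_apply, T.d_θ, ih, map_smul, pow_succ]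
    simp

theorem θ_pow_K (m : ℕ) (x : B) : (T.θ ^ m) (T.K x) = (-1 : k) ^ m • T.K ((T.θ ^ m) x) := by
  induction m with
  | zero => simp
  | succ m ih =>
    rw [pow_succ', AlgHom.mul_apply, AlgHom.mul_apply, ih, map_smul, T.θ_K, pow_succ]
    simp

theorem K_one : T.K 1 = 0 := T.K_zero 1 D.one_mem_deg

/-- The summand of the braiding on forms whose left factor has degree `n`. -/
def braidAux (n : ℕ) : B →ₗ[k] B →ₗ[k] B ⊗[k] B :=
  ((TensorProduct.mk k B B).compl₁₂ (T.θ ^ n).toLinearMap LinearMap.id).flip -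
    ((TensorProduct.mk k B B).compl₁₂ (T.K ∘ₗ (T.θ ^ n).toLinearMap) D.d).flip

theorem braidAux_apply (n : ℕ) (x y : B) : T.braidAux n x y =
    (T.θ ^ n) y ⊗ₜ[k] x - T.K ((T.θ ^ n) y) ⊗ₜ[k] D.d x := rfl

/-- The braiding defined by a twisted commutativity. -/
def braid : B ⊗[k] B →ₗ[k] B ⊗[k] B :=
  TensorProduct.lift (DirectSum.toModule k ℕ (B →ₗ[k] B ⊗[k] B)
      (fun n => T.braidAux n ∘ₗ (D.deg n).subtype) ∘ₗ
    (DirectSum.decomposeLinearEquiv D.deg).toLinearMap)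

theorem braid_tmul {n : ℕ} {x : B} (hx : x ∈ D.deg n) (y : B) : T.braid (x ⊗ₜ[k] y) =
    (T.θ ^ n) y ⊗ₜ[k] x - T.K ((T.θ ^ n) y) ⊗ₜ[k] D.d x := by
  rw [← braidAux_apply]
  simp only [braid, TensorProduct.lift.tmul, LinearMap.comp_apply, LinearEquiv.coe_coe,
    DirectSum.decomposeLinearEquiv_apply, DirectSum.decompose_of_mem D.deg hx]
  exact LinearMap.congr_fun (DirectSum.toModule_lof (M := fun n => D.deg n) k n ⟨x, hx⟩) y

theorem braid_d {n : ℕ} {x : B} (hx : x ∈ D.deg n) (y : B) : T.braid (D.d x ⊗ₜ[k] y) =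
    (T.θ ^ (n + 1)) y ⊗ₜ[k] D.d x := by
  rw [T.braid_tmul (D.d_mem n x hx), D.d_d, TensorProduct.tmul_zero, sub_zero]

/-- `K x` has degree `n - 1`, so one power of `θ` is missing; taking `θ y` as right argument
restores it, avoids subtraction, and leaves a true statement `0 = 0` for `n = 0`. -/
theorem braid_K {n : ℕ} {x : B} (hx : x ∈ D.deg n) (y : B) : T.braid (T.K x ⊗ₜ[k] T.θ y) =
    (T.θ ^ n) y ⊗ₜ[k] T.K x - T.K ((T.θ ^ n) y) ⊗ₜ[k] D.d (T.K x) := by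
  cases n with
  | zero => rw [T.K_zero x hx]; simp
  | succ n => rw [T.braid_tmul (T.K_succ n x hx), pow_succ, AlgHom.mul_apply]

theorem θ_pow_add (m n : ℕ) (x : B) : (T.θ ^ m) ((T.θ ^ n) x) = (T.θ ^ (m + n)) x := by
  rw [pow_add, AlgHom.mul_apply]

theorem θ_pow_comm (m n : ℕ) (x : B) : (T.θ ^ m) ((T.θ ^ n) x) = (T.θ ^ n) ((T.θ ^ m) x) := by
  rw [θ_pow_add, add_comm, θ_pow_add]

end TwistedComm

section Legs

@[simp] theorem on12_tmul (f : B ⊗[k] B →ₗ[k] B ⊗[k] B) (x y z : B) :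
    on12 f (x ⊗ₜ[k] (y ⊗ₜ[k] z)) = TensorProduct.assoc k B B B (f (x ⊗ₜ[k] y) ⊗ₜ[k] z) := rfl

@[simp] theorem on23_tmul (f : B ⊗[k] B →ₗ[k] B ⊗[k] B) (x : B) (t : B ⊗[k] B) :
    on23 f (x ⊗ₜ[k] t) = x ⊗ₜ[k] f t := rfl

@[simp] theorem mul12_tmul (x y z : B) :
    mul12 k B (x ⊗ₜ[k] (y ⊗ₜ[k] z)) = (x * y) ⊗ₜ[k] z := rfl

@[simp] theorem mul23_tmul (x y z : B) :
    mul23 k B (x ⊗ₜ[k] (y ⊗ₜ[k] z)) = x ⊗ₜ[k] (y * z) := rfl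

end Legs

namespace DGStructure

variable (D : DGStructure k B)

theorem tensor_ext {C : Type*} [AddCommMonoid C] [Module k C] {f g : B ⊗[k] B →ₗ[k] C}
    (h : ∀ m, ∀ x ∈ D.deg m, ∀ n, ∀ y ∈ D.deg n, f (x ⊗ₜ[k] y) = g (x ⊗ₜ[k] y)) : f = g :=
  TensorProduct.ext (D.linearMap_ext_deg fun m x hx => D.linearMap_ext_deg fun n y hy => by
    simpa using h m x hx n y hy)

/-- The last factor may stay arbitrary: in the braid identities it only occurs as the right argument
of the braiding, whose formula needs the degree of the left argument alone. -/
theorem tensor_ext₃ {C : Type*} [AddCommMonoid C] [Module k C]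
    {f g : B ⊗[k] (B ⊗[k] B) →ₗ[k] C}
    (h : ∀ m, ∀ x ∈ D.deg m, ∀ n, ∀ y ∈ D.deg n, ∀ z,
      f (x ⊗ₜ[k] (y ⊗ₜ[k] z)) = g (x ⊗ₜ[k] (y ⊗ₜ[k] z))) : f = g :=
  TensorProduct.ext (D.linearMap_ext_deg fun m x hx => TensorProduct.ext
    (D.linearMap_ext_deg fun n y hy => LinearMap.ext fun z => by simpa using h m x hx n y hy z))

end DGStructure

namespace TwistedComm

variable {D : DGStructure k B} (T : TwistedComm D)

/-- Both sides are sums of tensors ending in `x` or in `dx`. Those ending in `x` agree because `θ`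
commutes with `d` and `K` up to sign; those ending in `dx` agree by the homotopy relation `d_K`; the
terms with two factors `K` on `z` vanish by `K_K`. -/
theorem braid_yang_baxter : on12 T.braid ∘ₗ on23 T.braid ∘ₗ on12 T.braid =
    on23 T.braid ∘ₗ on12 T.braid ∘ₗ on23 T.braid := by
  refine D.tensor_ext₃ fun p x hx q y hy z => ?_
  have hy' : (T.θ ^ p) y ∈ D.deg q := T.θ_pow_mem p hy
  have e1 : T.braid (T.K ((T.θ ^ p) y) ⊗ₜ[k] (T.θ ^ (p + 1)) z) =
      (T.θ ^ q) ((T.θ ^ p) z) ⊗ₜ[k] T.K ((T.θ ^ p) y) -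
        T.K ((T.θ ^ q) ((T.θ ^ p) z)) ⊗ₜ[k] D.d (T.K ((T.θ ^ p) y)) := by
    rw [pow_succ', AlgHom.mul_apply, T.braid_K hy']
  -- The homotopy relation at `θ ^ p y`, solved for the term in which `K` meets the differential.
  have e2 : T.K ((T.θ ^ p) (D.d y)) = (-1 : k) ^ p • (D.d (T.K ((T.θ ^ p) y)) -
      (-1 : k) ^ q • (T.θ ^ p) y + (T.θ ^ (p + 1)) y) := by
    rw [T.d_K, D.sgn_of_mem hy', T.d_θ_pow, pow_succ' T.θ, AlgHom.mul_apply, add_sub_right_comm,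
      add_sub_cancel_right, sub_add_cancel, map_smul, smul_smul, ← pow_add, ← two_mul, pow_mul]
    simp
  have hs : ((-1 : k) ^ p) * (-1) ^ p = 1 := by rw [← mul_pow]; simp
  simp only [LinearMap.comp_apply, on12_tmul, on23_tmul, T.braid_tmul hx, T.braid_tmul hy,
    T.braid_tmul hy', T.braid_d hx, map_sub, TensorProduct.sub_tmul, TensorProduct.tmul_sub,
    TensorProduct.assoc_tmul, e1, T.K_K, smul_zero, TensorProduct.zero_tmul, sub_zero, T.d_θ_pow,
    e2, TensorProduct.tmul_smul, ← TensorProduct.smul_tmul', T.θ_pow_K, T.θ_pow_comm p q,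
    TensorProduct.tmul_add, TensorProduct.add_tmul, smul_add, smul_sub, map_smul]
  simp only [smul_smul, ← mul_assoc, hs, one_smul, one_mul]
  abel

/-- The terms in `x` match since `θ` is multiplicative, the terms in `dx` by the twisted Leibniz
rule `K_mul`. -/
theorem braid_compat_right :
    mul12 k B ∘ₗ on23 T.braid ∘ₗ on12 T.braid = T.braid ∘ₗ mul23 k B := by
  refine D.tensor_ext₃ fun p x hx q y hy z => ?_
  simp only [LinearMap.comp_apply, on12_tmul, on23_tmul, T.braid_tmul hx, T.braid_d hx, map_sub,
    TensorProduct.sub_tmul, TensorProduct.tmul_sub, TensorProduct.assoc_tmul, mul12_tmul,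
    mul23_tmul, map_mul, T.K_mul, TensorProduct.add_tmul, pow_succ', AlgHom.mul_apply]
  abel

/-- Dual to the previous case: here the Leibniz rule of `d` is matched, and the term in `dx dy`
drops out because `K θ ^ p K = 0`. -/
theorem braid_compat_left :
    mul23 k B ∘ₗ on12 T.braid ∘ₗ on23 T.braid = T.braid ∘ₗ mul12 k B := by
  refine D.tensor_ext₃ fun p x hx q y hy z => ?_
  simp only [LinearMap.comp_apply, on12_tmul, on23_tmul, T.braid_tmul hx, T.braid_tmul hy,
    T.braid_tmul (D.mul_mem_deg hx hy), map_sub,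
    TensorProduct.sub_tmul, TensorProduct.tmul_sub, TensorProduct.assoc_tmul, mul12_tmul,
    mul23_tmul, T.K_K, T.θ_pow_K, TensorProduct.zero_tmul, sub_zero, map_smul, smul_zero,
    D.leibniz p x y hx, TensorProduct.tmul_add, TensorProduct.tmul_smul,
    ← TensorProduct.smul_tmul', T.θ_pow_add]
  abel

/-- The axiom `μ R = μ` is literally `mul_comm`, and compatibility with the differential is the
homotopy relation `d_K` once more. -/
theorem braid_isDGBraiding : D.IsDGBraiding T.braid where
  unit_left y := by rw [T.braid_tmul D.one_mem_deg, D.d_one]; simp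
  unit_right x := by
    induction x using D.induction_deg with
    | hadd x y hx hy => rw [TensorProduct.add_tmul, map_add, hx, hy, TensorProduct.tmul_add]
    | h n x hx => rw [T.braid_tmul hx, map_one, T.K_one]; simp
  yang_baxter := T.braid_yang_baxter
  compat_right := T.braid_compat_right
  compat_left := T.braid_compat_left
  mul_comp := D.tensor_ext fun p x hx q y hy => by
    rw [LinearMap.comp_apply, T.braid_tmul hx, map_sub, LinearMap.mul'_apply, LinearMap.mul'_apply,
      LinearMap.mul'_apply, ← T.mul_comm p x hx]
  map_deg n t ht := by
    induction ht using Submodule.span_induction with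
    | zero => rw [map_zero]; exact zero_mem _
    | add x y _ _ hx hy => rw [map_add]; exact add_mem hx hy
    | smul c x _ hx => rw [map_smul]; exact Submodule.smul_mem _ _ hx
    | mem t ht =>
      obtain ⟨p, q, rfl, x, hx, y, hy, rfl⟩ := ht
      rw [T.braid_tmul hx]
      refine sub_mem (Submodule.subset_span
        ⟨q, p, add_comm _ _, _, T.θ_pow_mem p hy, _, hx, rfl⟩) ?_
      -- `K` lowers the degree by one, so the second summand must vanish when `y` has degree zero.
      cases q with
      | zero => rw [T.K_zero _ (T.θ_pow_mem p hy), TensorProduct.zero_tmul]; exact zero_mem _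
      | succ q =>
        exact Submodule.subset_span
          ⟨q, p + 1, by omega, _, T.K_succ q _ (T.θ_pow_mem p hy), _, D.d_mem _ _ hx, rfl⟩
  comm_d := D.tensor_ext fun p x hx q y hy => by
    have hy' : (T.θ ^ p) y ∈ D.deg q := T.θ_pow_mem p hy
    have e2 := T.d_K ((T.θ ^ p) y)
    rw [D.sgn_of_mem hy', T.d_θ_pow, map_smul] at e2
    -- The sign map would act on `K (θ ^ p y)`, but its term carries `d (d x) = 0`.
    have e3 : D.tensorD (T.K ((T.θ ^ p) y) ⊗ₜ[k] D.d x) =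
        D.d (T.K ((T.θ ^ p) y)) ⊗ₜ[k] D.d x := by
      simp [DGStructure.tensorD, D.d_d]
    rw [LinearMap.comp_apply, LinearMap.comp_apply, D.tensorD_tmul hx, map_add, map_smul,
      T.braid_d hx, T.braid_tmul hx, T.braid_tmul hx, map_sub, D.tensorD_tmul hy', e3, e2,
      T.d_θ_pow, pow_succ' T.θ, AlgHom.mul_apply]
    simp only [TensorProduct.add_tmul, TensorProduct.sub_tmul, TensorProduct.smul_tmul', smul_sub]
    abel

end TwistedComm

end General

/-! ### Twisted forms: induction principles and basic relations -/

section TwistedI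

variable {k : Type*} [CommRing k] {A : Type*} [CommRing A] [Algebra k A]
  {B : Type*} [CommRing B] [Algebra k B]

/-- A one-form is a sum of terms `a dc`, so a form `x m` is a sum of terms `(x a) dc`. The inductive
hypothesis is thus needed for right multiples `x a`, which is why the claim is first strengthened to
all `x * b`. -/
theorem Univ.induction_mul_d {P : ℕ → Univ k A → Prop}
    (add : ∀ n x y, P n x → P n y → P n (x + y)) (zero : ∀ a, P 0 (Univ.inA k A a))
    (succ : ∀ n, ∀ x ∈ Univ.deg k A n, ∀ a, P n x →
      P (n + 1) (x * Univ.inΩ k A (univD k a)))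
    {n : ℕ} {x : Univ k A} (hx : x ∈ Univ.deg k A n) : P n x := by
  suffices h : ∀ b, P n (x * Univ.inA k A b) by simpa using h 1
  induction hx using Univ.deg_induction with
  | add n x y hx hy h1 h2 => intro b; rw [add_mul]; exact add _ _ _ (h1 b) (h2 b)
  | zero a => intro b; rw [← map_mul]; exact zero _
  | succ n x hx m h =>
    intro b
    have key : ∀ t : A ⊗[k] A, P (n + 1) (x * Univ.hh k A t) := by
      intro t
      induction t using TensorProduct.induction_on with
      | zero =>
        have := succ n _ (SetLike.mul_mem_graded (i := n) (j := 0) hx (Univ.inA_mem k A 0)) 0 (h 0)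
        simpa using this
      | tmul a c =>
        have := succ n _ (SetLike.mul_mem_graded (i := n) (j := 0) hx (Univ.inA_mem k A a)) c (h a)
        rw [mul_assoc] at this
        exact this
      | add s t hs ht => rw [map_add, mul_add]; exact add _ _ _ hs ht
    have := key (rsmul k m b : OneForms k A)
    rwa [Univ.hh_eq, Univ.inΩ_rsmul, ← mul_assoc] at this

namespace Twisted

variable (α : A →ₐ[k] A)

/-- The projection from universal forms to twisted forms. -/
def proj : Univ k A →ₐ[k] Twisted α := Ideal.Quotient.mkₐ k _

theorem proj_surjective : Function.Surjective (proj α) := Ideal.Quotient.mkₐ_surjective k _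

theorem proj_inA (a : A) : proj α (Univ.inA k A a) = ofA α a := rfl

theorem proj_d (x : Univ k A) : proj α (Univ.d k A x) = (dg α).d (proj α x) := rfl

theorem d_ofA (a : A) : (dg α).d (ofA α a) = proj α (Univ.inΩ k A (univD k a)) := by
  rw [← proj_inA, ← proj_d, Univ.d_inA]

theorem proj_mem {n : ℕ} {x : Univ k A} (hx : x ∈ Univ.deg k A n) : proj α x ∈ (dg α).deg n :=
  ⟨x, hx, rfl⟩

theorem exists_proj {n : ℕ} {x : Twisted α} (hx : x ∈ (dg α).deg n) :
    ∃ y ∈ Univ.deg k A n, proj α y = x := hx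

theorem ofA_mem (a : A) : ofA α a ∈ (dg α).deg 0 := proj_mem α (Univ.inA_mem k A a)

theorem d_ofA_mem (a : A) : (dg α).d (ofA α a) ∈ (dg α).deg 1 := (dg α).d_mem 0 _ (ofA_mem α a)

theorem map_proj {α : A →ₐ[k] A} {β : B →ₐ[k] B} (f : A →ₐ[k] B) (hf : f.comp α = β.comp f)
    (x : Univ k A) : map f hf (proj α x) = proj β (Univ.map f x) := rfl

theorem map_ofA {α : A →ₐ[k] A} {β : B →ₐ[k] B} (f : A →ₐ[k] B) (hf : f.comp α = β.comp f)
    (a : A) : map f hf (ofA α a) = ofA β (f a) := by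
  rw [← proj_inA, map_proj, Univ.map_inA, proj_inA]

theorem map_d {α : A →ₐ[k] A} {β : B →ₐ[k] B} (f : A →ₐ[k] B) (hf : f.comp α = β.comp f)
    (x : Twisted α) : map f hf ((dg α).d x) = (dg β).d (map f hf x) := by
  obtain ⟨x, rfl⟩ := proj_surjective α x
  rw [← proj_d, map_proj, map_proj, Univ.map_d, proj_d]

theorem map_mem {α : A →ₐ[k] A} {β : B →ₐ[k] B} (f : A →ₐ[k] B) (hf : f.comp α = β.comp f)
    {n : ℕ} {x : Twisted α} (hx : x ∈ (dg α).deg n) : map f hf x ∈ (dg β).deg n := by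
  obtain ⟨x, hx', rfl⟩ := exists_proj α hx
  exact proj_mem β (Univ.map_mem f hx')

theorem bar_ofA (a : A) : bar α (ofA α a) = ofA α (α a) := map_ofA α rfl a

theorem bar_d (x : Twisted α) : bar α ((dg α).d x) = (dg α).d (bar α x) := map_d α rfl x

theorem bar_mem {n : ℕ} {x : Twisted α} (hx : x ∈ (dg α).deg n) : bar α x ∈ (dg α).deg n :=
  map_mem α rfl hx

variable {α} in
theorem induction_mul_d {P : ℕ → Twisted α → Prop}
    (add : ∀ n x y, P n x → P n y → P n (x + y)) (zero : ∀ a, P 0 (ofA α a))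
    (succ : ∀ n, ∀ x ∈ (dg α).deg n, ∀ a, P n x → P (n + 1) (x * (dg α).d (ofA α a)))
    {n : ℕ} {x : Twisted α} (hx : x ∈ (dg α).deg n) : P n x := by
  obtain ⟨x, hx', rfl⟩ := exists_proj α hx
  refine Univ.induction_mul_d (P := fun n x => P n (proj α x)) ?_ zero ?_ hx'
  · intro n x y h1 h2; rw [map_add]; exact add _ _ _ h1 h2
  · intro n x hx a h; rw [map_mul, ← d_ofA]; exact succ n _ (proj_mem α hx) a h

variable {α} in
theorem induction_gen {P : Twisted α → Prop} (add : ∀ x y, P x → P y → P (x + y))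
    (mul : ∀ x y, P x → P y → P (x * y)) (ofA : ∀ a, P (ofA α a))
    (d : ∀ a, P ((dg α).d (Twisted.ofA α a))) (x : Twisted α) : P x := by
  induction x using (dg α).induction_deg with
  | hadd x y hx hy => exact add x y hx hy
  | h n x hx =>
    exact induction_mul_d (P := fun _ x => P x) (fun _ => add) ofA
      (fun n x _ a h => mul _ _ h (d a)) hx

theorem d_mul_d (x : Twisted α) (a : A) :
    (dg α).d (x * (dg α).d (ofA α a)) = (dg α).d x * (dg α).d (ofA α a) := by
  rw [(dg α).d_mul, (dg α).d_d, mul_zero, add_zero]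

theorem d_ofA_mul_ofA (a b : A) :
    (dg α).d (ofA α a) * ofA α b = ofA α (α b) * (dg α).d (ofA α a) := by
  have h := (univDG k A).subset_diffIdeal (twistRel α) ⟨a, b, rfl⟩
  have h2 : proj α (Univ.d k A (Univ.inA k A a) * Univ.inA k A b -
    Univ.inA k A (α b) * Univ.d k A (Univ.inA k A a)) = 0 := Ideal.Quotient.eq_zero_iff_mem.2 h
  rw [map_sub, map_mul, map_mul, proj_d] at h2
  exact sub_eq_zero.1 h2

/-- The differential of the defining relation `da b = α(b) da`. -/
theorem d_ofA_mul_d_ofA (a b : A) : (dg α).d (ofA α a) * (dg α).d (ofA α b) =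
    -((dg α).d (ofA α (α b)) * (dg α).d (ofA α a)) := by
  have h := congrArg (dg α).d (d_ofA_mul_ofA α a b)
  rw [d_mul_d, (dg α).d_mul, (dg α).d_d, zero_mul, zero_add,
    (dg α).sgn_of_mem (d_ofA_mem α a)] at h
  rw [← h]; simp

theorem d_ofA_mul (a b : A) : (dg α).d (ofA α (a * b)) =
    ofA α (α b) * (dg α).d (ofA α a) + ofA α a * (dg α).d (ofA α b) := by
  rw [map_mul, (dg α).d_mul, (dg α).sgn_of_mem (ofA_mem α a), d_ofA_mul_ofA]; simp

/-- Compare the expansions of `d(ab)` and `d(ba)`. This symmetry is what makes functions commute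
with exact one-forms up to `K`, and later what makes `primitive` independent of choices. -/
theorem sub_mul_d_comm (a b : A) : ofA α (a - α a) * (dg α).d (ofA α b) =
    ofA α (b - α b) * (dg α).d (ofA α a) := by
  have h := d_ofA_mul α a b
  rw [mul_comm a b, d_ofA_mul α b a] at h
  rw [map_sub, map_sub, sub_mul, sub_mul, sub_eq_sub_iff_add_eq_add, add_comm, ← h, add_comm]

/-! ### The integration map -/

/-- The map `∑ aᵢ dbᵢ ↦ ∑ aᵢ (bᵢ - α bᵢ)` on universal one-forms. -/
def intOne : OneForms k A →ₗ[k] A :=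
  -- On the kernel of the multiplication `∑ aᵢ bᵢ = 0`, so that `∑ aᵢ (bᵢ - α bᵢ)` is just `-∑ aᵢ
  -- α(bᵢ)`.
  -(((Algebra.TensorProduct.lmul' k (S := A)).comp
      (Algebra.TensorProduct.map (AlgHom.id k A) α)).toLinearMap ∘ₗ
    ((KaehlerDifferential.ideal k A).restrictScalars k).subtype)

theorem intOne_apply (m : OneForms k A) : intOne α m =
    -Algebra.TensorProduct.lmul' k (S := A)
      (Algebra.TensorProduct.map (AlgHom.id k A) α (m : A ⊗[k] A)) := rfl

theorem intOne_univD (a : A) : intOne α (univD k a) = a - α a := by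
  simp [intOne_apply, Univ.coe_univD]

theorem intOne_lsmul (a : A) (m : OneForms k A) :
    intOne α (lsmul k a m) = a * intOne α m := by
  simp [intOne_apply, lsmul]

theorem intOne_rsmul (m : OneForms k A) (a : A) :
    intOne α (rsmul k m a) = intOne α m * α a := by
  simp [intOne_apply, rsmul, mul_comm]

/-- The matrix of a function. -/
def intMatA : A →ₐ[k] Matrix (Fin 2) (Fin 2) (Twisted α) :=
  AlgHom.ofLinearMap
    { toFun := fun a => !![ofA α a, 0; 0, ofA α (α a)]
      map_add' := fun a b => by
        ext i j; fin_cases i <;> fin_cases j <;> simp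
      map_smul' := fun c a => by
        ext i j; fin_cases i <;> fin_cases j <;> simp }
    (by ext i j; fin_cases i <;> fin_cases j <;> simp)
    (fun a b => by
      ext i j; fin_cases i <;> fin_cases j <;>
        simp [Matrix.mul_apply, Fin.sum_univ_two])

/-- The matrix of a one-form. -/
def intMatΩ : OneForms k A →ₗ[k] Matrix (Fin 2) (Fin 2) (Twisted α) where
  toFun m := !![-proj α (Univ.inΩ k A m), ofA α (intOne α m); 0, bar α (proj α (Univ.inΩ k A m))]
  map_add' a b := by
    simp only [map_add, neg_add]
    ext i j; fin_cases i <;> fin_cases j <;> simp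
  map_smul' c a := by
    simp only [map_smul, RingHom.id_apply]
    ext i j; fin_cases i <;> fin_cases j <;> simp

theorem intMatA_apply (a : A) : intMatA α a = !![ofA α a, 0; 0, ofA α (α a)] := rfl

theorem intMatΩ_apply (m : OneForms k A) : intMatΩ α m =
    !![-proj α (Univ.inΩ k A m), ofA α (intOne α m); 0, bar α (proj α (Univ.inΩ k A m))] := rfl

/-- The algebra map that sends a form `x` of degree `n` to the upper triangular matrix with
diagonal `(-1) ^ n x`, `α x` and with the integral of `x` in the corner. -/
def intMat : Univ k A →ₐ[k] Matrix (Fin 2) (Fin 2) (Twisted α) :=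
  Univ.lift (intMatA α) (intMatΩ α)
    (fun a m => by
      rw [intMatA_apply, intMatΩ_apply, intMatΩ_apply]
      ext i j; fin_cases i <;> fin_cases j <;>
        simp [Matrix.mul_apply, Fin.sum_univ_two, Univ.inΩ_lsmul, intOne_lsmul, proj_inA, bar_ofA])
    (fun m a => by
      rw [intMatA_apply, intMatΩ_apply, intMatΩ_apply]
      ext i j; fin_cases i <;> fin_cases j <;>
        simp [Matrix.mul_apply, Fin.sum_univ_two, Univ.inΩ_rsmul, intOne_rsmul, proj_inA, bar_ofA])

/-- The integration map, on universal forms. -/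
def preInt : Univ k A →ₗ[k] Twisted α :=
  Matrix.entryLinearMap k (Twisted α) 0 1 ∘ₗ (intMat α).toLinearMap

theorem preInt_apply (x : Univ k A) : preInt α x = intMat α x 0 1 := rfl

theorem preInt_inA (a : A) : preInt α (Univ.inA k A a) = 0 := by
  rw [preInt_apply, intMat, Univ.lift_inA, intMatA_apply]; rfl

theorem preInt_inΩ (m : OneForms k A) : preInt α (Univ.inΩ k A m) = ofA α (intOne α m) := by
  rw [preInt_apply, intMat, Univ.lift_inΩ, intMatΩ_apply]; rfl

theorem intMat_of_mem {n : ℕ} {x : Univ k A} (hx : x ∈ Univ.deg k A n) :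
    intMat α x = !![(-1 : k) ^ n • proj α x, preInt α x; 0, bar α (proj α x)] := by
  induction hx using Univ.deg_induction with
  | add n x y hx hy h1 h2 =>
    rw [map_add, h1, h2]
    ext i j; fin_cases i <;> fin_cases j <;> simp
  | zero a =>
    rw [preInt_inA, intMat, Univ.lift_inA, intMatA_apply]; simp [proj_inA, bar_ofA]
  | succ n x hx m h =>
    have hm : intMat α (Univ.inΩ k A m) = intMatΩ α m := Univ.lift_inΩ _ _ _ _ m
    have h3 := map_mul (intMat α) x (Univ.inΩ k A m)
    rw [h, hm, intMatΩ_apply] at h3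
    rw [preInt_apply, h3]
    ext i j; fin_cases i <;> fin_cases j <;> simp [Matrix.mul_apply, Fin.sum_univ_two, pow_succ]

theorem intMat_eq (x : Univ k A) :
    intMat α x = !![(dg α).sgn (proj α x), preInt α x; 0, bar α (proj α x)] := by
  induction x using (univDG k A).induction_deg with
  | hadd x y hx hy =>
    rw [map_add, hx, hy, map_add, map_add, map_add, map_add]
    ext i j; fin_cases i <;> fin_cases j <;> simp
  | h n x hx => rw [intMat_of_mem α hx, (dg α).sgn_of_mem (proj_mem α hx)]

theorem preInt_mul {n : ℕ} {x : Univ k A} (hx : x ∈ Univ.deg k A n) (y : Univ k A) :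
    preInt α (x * y) =
      preInt α x * bar α (proj α y) + (-1 : k) ^ n • (proj α x * preInt α y) := by
  rw [preInt_apply, map_mul, intMat_eq, intMat_eq, (dg α).sgn_of_mem (proj_mem α hx)]
  simp [add_comm]

/-- On functions this is the value of the integral on `da`. For `x da`, both integrals are expanded
by the Leibniz rule; the two terms `dx (a - α a)` have opposite signs and cancel, and the formula
for `x` gives the rest. -/
theorem d_preInt (x : Univ k A) : (dg α).d (preInt α x) + preInt α (Univ.d k A x) =
    proj α x - bar α (proj α x) := by
  induction x using (univDG k A).induction_deg with
  | hadd x y hx hy =>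
    simp only [map_add]
    rw [add_sub_add_comm, ← hx, ← hy]; abel
  | h n x hx =>
    refine Univ.induction_mul_d (P := fun n x => (dg α).d (preInt α x) + preInt α (Univ.d k A x) =
      proj α x - bar α (proj α x)) ?_ ?_ ?_ hx
    · intro n x y hx hy
      simp only [map_add]
      rw [add_sub_add_comm, ← hx, ← hy]; abel
    · intro a
      rw [preInt_inA, Univ.d_inA, preInt_inΩ, intOne_univD, proj_inA, bar_ofA, map_sub, map_zero,
        zero_add]
    · intro n x hx a h
      have hx' := proj_mem α hx
      have e : Univ.d k A (x * Univ.inΩ k A (univD k a)) =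
          Univ.d k A x * Univ.inΩ k A (univD k a) := by
        rw [Univ.d_mul k hx, Univ.d_inΩ, Univ.dΩ_univD, mul_zero, smul_zero, add_zero]
      rw [e, preInt_mul α hx, preInt_mul α (Univ.d_mem k hx), preInt_inΩ, intOne_univD, map_mul,
        map_mul, ← d_ofA, map_add, map_smul, (dg α).leibniz n _ _ hx', bar_d, bar_ofA, d_mul_d,
        eq_sub_of_add_eq' h, proj_d, pow_succ, map_sub (ofA α), map_sub (dg α).d]
      have hs : (-1 : k) ^ n * (-1) ^ n = 1 := by rw [← mul_pow]; simp
      simp only [sub_mul, mul_sub, smul_add, smul_sub, smul_smul, hs, one_smul, mul_neg, mul_one,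
        neg_smul]
      abel

/-- The integral is not multiplicative, but its common kernel with `proj` is the kernel of the
algebra map `Φ`, hence a two-sided ideal. The homotopy formula makes it stable under `d`, and it
contains the relations because `(a - α a) α(b) = α(b) (a - α a)` in `A`. -/
theorem preInt_eq_zero (x : Univ k A) (hx : x ∈ (univDG k A).diffIdeal (twistRel α)) :
    preInt α x = 0 := by
  let Φ : Univ k A →ₐ[k] Matrix (Fin 2) (Fin 2) (Twisted α) × Twisted α :=
    (intMat α).prod (proj α)
  have hΦ : ∀ y, y ∈ RingHom.ker Φ ↔ proj α y = 0 ∧ preInt α y = 0 := by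
    intro y
    rw [RingHom.mem_ker]
    change (intMat α y, proj α y) = 0 ↔ _
    rw [Prod.mk_eq_zero, intMat_eq]
    constructor
    · rintro ⟨h1, h2⟩
      exact ⟨h2, congrFun (congrFun h1 0) 1⟩
    · rintro ⟨h1, h2⟩
      refine ⟨?_, h1⟩
      rw [h1, h2]
      ext i j; fin_cases i <;> fin_cases j <;> simp
  refine ((hΦ x).1 ((univDG k A).mem_diffIdeal.1 hx (RingHom.ker Φ) inferInstance ?_ ?_)).2
  · intro y hy
    rw [hΦ] at hy ⊢
    have h := d_preInt α y
    rw [hy.1, hy.2, map_zero, map_zero, zero_add, sub_zero] at h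
    exact ⟨(proj_d α y).trans (by rw [hy.1, map_zero]), h⟩
  · rintro y ⟨a, b, rfl⟩
    rw [SetLike.mem_coe, hΦ]
    have h := (univDG k A).subset_diffIdeal (twistRel α) ⟨a, b, rfl⟩
    refine ⟨Ideal.Quotient.eq_zero_iff_mem.2 h, ?_⟩
    rw [map_sub, Univ.d_inA, preInt_mul α (Univ.inΩ_mem k A _), preInt_mul α (Univ.inA_mem k A _),
      preInt_inA, preInt_inA, preInt_inΩ, intOne_univD, proj_inA, proj_inA, bar_ofA]
    simp only [mul_zero, smul_zero, add_zero, zero_mul, pow_zero, one_smul, zero_add]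
    rw [← map_mul, ← map_mul, mul_comm, sub_self]

/-- The integration map `I`. -/
def int : Twisted α →ₗ[k] Twisted α :=
  DGStructure.quotLift _ (preInt α) (preInt_eq_zero α)

theorem int_proj (x : Univ k A) : int α (proj α x) = preInt α x := rfl

theorem int_ofA (a : A) : int α (ofA α a) = 0 := preInt_inA α a

theorem int_d_ofA (a : A) : int α ((dg α).d (ofA α a)) = ofA α (a - α a) := by
  rw [d_ofA, int_proj, preInt_inΩ, intOne_univD]

theorem int_mul (x y : Twisted α) :
    int α (x * y) = int α x * bar α y + (dg α).sgn x * int α y := by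
  obtain ⟨y, rfl⟩ := proj_surjective α y
  induction x using (dg α).induction_deg with
  | hadd x x' h h' => simp only [add_mul, map_add, h, h']; abel
  | h n x hx =>
    obtain ⟨x, hx', rfl⟩ := exists_proj α hx
    rw [(dg α).sgn_of_mem hx, ← map_mul, int_proj, int_proj, int_proj, preInt_mul α hx',
      smul_mul_assoc]

theorem d_int (x : Twisted α) :
    (dg α).d (int α x) + int α ((dg α).d x) = x - bar α x := by
  obtain ⟨x, rfl⟩ := proj_surjective α x
  exact d_preInt α x

/-- Both assertions go through one induction: in `I(x da)` the term `I(x) dα(a)` has to vanish if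
`x` has degree zero, and has degree `|x|` otherwise. -/
theorem int_mem (n : ℕ) (x : Twisted α) (hx : x ∈ (dg α).deg n) :
    (n = 0 → int α x = 0) ∧ ∀ m, n = m + 1 → int α x ∈ (dg α).deg m := by
  refine induction_mul_d (P := fun n x => (n = 0 → int α x = 0) ∧
    ∀ m, n = m + 1 → int α x ∈ (dg α).deg m) ?_ ?_ ?_ hx
  · rintro n x y ⟨h1, h2⟩ ⟨h3, h4⟩
    refine ⟨fun h => ?_, fun m h => ?_⟩
    · rw [map_add, h1 h, h3 h, add_zero]
    · rw [map_add]; exact add_mem (h2 m h) (h4 m h)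
  · exact fun a => ⟨fun _ => int_ofA α a, fun m h => by omega⟩
  · rintro n x hx a ⟨h1, h2⟩
    refine ⟨fun h => by omega, fun m h => ?_⟩
    obtain rfl : n = m := by omega
    rw [int_mul, int_d_ofA]
    refine add_mem ?_ ((dg α).mul_mem_deg (n := 0) ((dg α).sgn_mem hx) (ofA_mem α _))
    cases n with
    | zero => rw [h1 rfl, zero_mul]; exact zero_mem _
    | succ n => exact (dg α).mul_mem_deg (h2 n rfl) (bar_mem α (d_ofA_mem α a))

theorem int_deg_zero {x : Twisted α} (hx : x ∈ (dg α).deg 0) : int α x = 0 :=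
  (int_mem α 0 x hx).1 rfl

theorem int_deg_succ {n : ℕ} {x : Twisted α} (hx : x ∈ (dg α).deg (n + 1)) :
    int α x ∈ (dg α).deg n := (int_mem α _ x hx).2 n rfl

theorem sgn_int (x : Twisted α) : (dg α).sgn (int α x) = -int α ((dg α).sgn x) := by
  induction x using (dg α).induction_deg with
  | hadd x y hx hy => simp only [map_add, hx, hy, neg_add]
  | h n x hx =>
    rw [(dg α).sgn_of_mem hx, map_smul]
    cases n with
    | zero => rw [int_deg_zero α hx]; simp
    | succ n => rw [(dg α).sgn_of_mem (int_deg_succ α hx), pow_succ]; simp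

theorem map_sgn {α : A →ₐ[k] A} {β : B →ₐ[k] B} (f : A →ₐ[k] B) (hf : f.comp α = β.comp f)
    (x : Twisted α) : map f hf ((dg α).sgn x) = (dg β).sgn (map f hf x) := by
  induction x using (dg α).induction_deg with
  | hadd x y hx hy => simp only [map_add, hx, hy]
  | h n x hx => rw [(dg α).sgn_of_mem hx, (dg β).sgn_of_mem (map_mem f hf hx), map_smul]

theorem map_bar {α : A →ₐ[k] A} {β : B →ₐ[k] B} (f : A →ₐ[k] B) (hf : f.comp α = β.comp f)
    (x : Twisted α) : map f hf (bar α x) = bar β (map f hf x) := by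
  induction x using induction_gen with
  | add x y hx hy => simp only [map_add, hx, hy]
  | mul x y hx hy => simp only [map_mul, hx, hy]
  | ofA a => rw [bar_ofA, map_ofA, map_ofA, bar_ofA]; exact congrArg _ (DFunLike.congr_fun hf a)
  | d a =>
    rw [bar_d, bar_ofA, map_d, map_d, map_ofA, map_ofA, bar_d, bar_ofA]
    exact congrArg _ (congrArg _ (DFunLike.congr_fun hf a))

/-- Both composites satisfy the same twisted Leibniz rule, so they need only be compared on `a` and
`da`. -/
theorem map_int {α : A →ₐ[k] A} {β : B →ₐ[k] B} (f : A →ₐ[k] B) (hf : f.comp α = β.comp f)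
    (x : Twisted α) : map f hf (int α x) = int β (map f hf x) := by
  induction x using induction_gen with
  | add x y hx hy => simp only [map_add, hx, hy]
  | mul x y hx hy => simp only [map_mul, map_add, int_mul, hx, hy, map_bar, map_sgn]
  | ofA a => rw [int_ofA, map_ofA, int_ofA, map_zero]
  | d a =>
    have h : f (α a) = β (f a) := DFunLike.congr_fun hf a
    rw [int_d_ofA, map_d, map_ofA, map_ofA, int_d_ofA, map_sub, h]

theorem bar_int (x : Twisted α) : bar α (int α x) = int α (bar α x) := map_int α rfl x

theorem bar_sgn (x : Twisted α) : bar α ((dg α).sgn x) = (dg α).sgn (bar α x) := map_sgn α rfl x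

/-- The cross terms of `I(I(xy))` cancel, since `I` anticommutes with the sign map and commutes with
`α`; on generators the claim is clear. -/
theorem int_int (x : Twisted α) : int α (int α x) = 0 := by
  induction x using induction_gen with
  | add x y hx hy => simp only [map_add, hx, hy, add_zero]
  | mul x y hx hy =>
    simp only [int_mul, map_add, hx, hy, sgn_int, bar_int, (dg α).sgn_sgn]
    simp
  | ofA a => rw [int_ofA, map_zero]
  | d a => rw [int_d_ofA, int_ofA]

/-! ### The braiding of twisted forms -/

/-- The twist `x ↦ (-1) ^ |x| α x`. -/
def twist : Twisted α →ₐ[k] Twisted α := (dg α).sgnHom.comp (bar α)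

theorem twist_apply (x : Twisted α) : twist α x = (dg α).sgn (bar α x) := rfl

theorem twist_ofA (a : A) : twist α (ofA α a) = ofA α (α a) := by
  rw [twist_apply, bar_ofA, (dg α).sgn_of_mem (ofA_mem α _)]; simp

theorem twist_d_ofA (a : A) : twist α ((dg α).d (ofA α a)) = -(dg α).d (ofA α (α a)) := by
  rw [twist_apply, bar_d, bar_ofA, (dg α).sgn_of_mem (d_ofA_mem α _)]; simp

theorem twist_pow_mem (p : ℕ) {q : ℕ} {y : Twisted α} (hy : y ∈ (dg α).deg q) :
    (twist α ^ p) y = (-1 : k) ^ (p * q) • (bar α)^[p] y := by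
  induction p with
  | zero => simp
  | succ p ih =>
    have h : (bar α)^[p] y ∈ (dg α).deg q := by
      clear ih
      induction p with
      | zero => exact hy
      | succ p ih => rw [Function.iterate_succ_apply']; exact bar_mem α ih
    rw [pow_succ', AlgHom.mul_apply, ih, map_smul, twist_apply,
      (dg α).sgn_of_mem (bar_mem α h), smul_smul, ← pow_add, Function.iterate_succ_apply']
    congr 2; ring

/-- The integration map precomposed with the sign. -/
def signedInt : Twisted α →ₗ[k] Twisted α := int α ∘ₗ (dg α).sgn

theorem signedInt_apply (x : Twisted α) : signedInt α x = int α ((dg α).sgn x) := rfl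

theorem signedInt_ofA (a : A) : signedInt α (ofA α a) = 0 := by
  rw [signedInt_apply, (dg α).sgn_of_mem (ofA_mem α _), map_smul, int_ofA, smul_zero]

theorem signedInt_d_ofA (a : A) :
    signedInt α ((dg α).d (ofA α a)) = -ofA α (a - α a) := by
  rw [signedInt_apply, (dg α).sgn_of_mem (d_ofA_mem α _), map_smul, int_d_ofA]; simp

/-- Precomposition with the sign map removes the sign that `int_mul` puts on the left factor, and
turns `α` into `twist` on the right one. -/
theorem signedInt_mul (x y : Twisted α) :
    signedInt α (x * y) = x * signedInt α y + signedInt α x * twist α y := by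
  rw [signedInt_apply, (dg α).sgn_mul, int_mul, (dg α).sgn_sgn, bar_sgn, add_comm]; rfl

/-- Moving `da` across `x` is multiplicative in `x`, so the two relations for `x = b` and `x = db`
suffice. -/
theorem d_ofA_mul_eq (a : A) (x : Twisted α) :
    (dg α).d (ofA α a) * x = twist α x * (dg α).d (ofA α a) := by
  induction x using induction_gen with
  | add x y hx hy => rw [mul_add, hx, hy, map_add, add_mul]
  | mul x y hx hy => rw [← mul_assoc, hx, mul_assoc, hy, map_mul, mul_assoc]
  | ofA b => rw [twist_ofA, d_ofA_mul_ofA]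
  | d b => rw [twist_d_ofA, d_ofA_mul_d_ofA, neg_mul]

/-- The commutator with `a` follows the Leibniz rule of `K`: once `da` appears it is carried across
the remaining factor by `twist`. The only real case is `x = db`, which is `sub_mul_d_comm`. -/
theorem ofA_mul_eq (a : A) (x : Twisted α) :
    ofA α a * x = x * ofA α a - signedInt α x * (dg α).d (ofA α a) := by
  induction x using induction_gen with
  | add x y hx hy => simp only [mul_add, add_mul, map_add, hx, hy]; abel
  | mul x y hx hy =>
    rw [← mul_assoc, hx, sub_mul, mul_assoc, hy, mul_assoc, d_ofA_mul_eq, signedInt_mul]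
    simp only [mul_sub, add_mul, mul_assoc]; abel
  | ofA b => rw [signedInt_ofA, zero_mul, sub_zero, ← map_mul, ← map_mul, mul_comm]
  | d b =>
    rw [signedInt_d_ofA, neg_mul, ← sub_mul_d_comm, d_ofA_mul_ofA, map_sub, sub_mul]; abel

theorem signedInt_signedInt (x : Twisted α) : signedInt α (signedInt α x) = 0 := by
  rw [signedInt_apply, signedInt_apply, sgn_int, map_neg, int_int, neg_zero]

theorem twist_signedInt (x : Twisted α) :
    twist α (signedInt α x) = -signedInt α (twist α x) := by
  simp only [signedInt_apply, twist_apply, bar_int, sgn_int, bar_sgn]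

/-- In `x da y` first `da` passes `y` at the cost of one `twist`, then `x` passes `twist y` by
induction; the last factors combine by `d(x da) = dx da`. -/
theorem mul_eq_twist {n : ℕ} {x : Twisted α} (hx : x ∈ (dg α).deg n) : ∀ y, x * y =
    (twist α ^ n) y * x - signedInt α ((twist α ^ n) y) * (dg α).d x := by
  refine induction_mul_d (P := fun n x => ∀ y, x * y =
    (twist α ^ n) y * x - signedInt α ((twist α ^ n) y) * (dg α).d x) ?_ ?_ ?_ hx
  · intro n x x' h h' y; simp only [add_mul, h, h', map_add, mul_add]; abel
  · intro a y; simpa using ofA_mul_eq α a y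
  · intro n x hx a h y
    rw [mul_assoc, d_ofA_mul_eq, ← mul_assoc, h, d_mul_d, pow_succ, AlgHom.mul_apply]
    simp only [sub_mul, mul_assoc]

/-- The twisted commutativity of twisted forms. -/
def twistedComm : TwistedComm (dg α) where
  θ := twist α
  K := signedInt α
  θ_mem n x hx := (dg α).sgn_mem (bar_mem α hx)
  d_θ x := by rw [twist_apply, (dg α).d_sgn, twist_apply, bar_d]
  K_zero x hx := int_deg_zero α ((dg α).sgn_mem hx)
  K_succ n x hx := int_deg_succ α ((dg α).sgn_mem hx)
  K_mul := signedInt_mul α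
  θ_K := twist_signedInt α
  K_K := signedInt_signedInt α
  d_K x := by
    -- The homotopy formula is applied to the signed form; moving `d` across the sign map turns the
    -- sum into a difference.
    have h := d_int α ((dg α).sgn x)
    rw [(dg α).d_sgn, map_neg, bar_sgn] at h
    rw [signedInt_apply, signedInt_apply, twist_apply, add_sub_assoc, ← h]; abel
  mul_comm n x hx y := mul_eq_twist α hx y

/-- The braiding of twisted forms. -/
def braid : Twisted α ⊗[k] Twisted α →ₗ[k] Twisted α ⊗[k] Twisted α := (twistedComm α).braid

theorem braid_tmul {n : ℕ} {x : Twisted α} (hx : x ∈ (dg α).deg n) (y : Twisted α) :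
    braid α (x ⊗ₜ[k] y) = (twist α ^ n) y ⊗ₜ[k] x -
      signedInt α ((twist α ^ n) y) ⊗ₜ[k] (dg α).d x := (twistedComm α).braid_tmul hx y

theorem braid_isDGBraiding : (dg α).IsDGBraiding (braid α) := (twistedComm α).braid_isDGBraiding

theorem braid_ofA (a : A) (y : Twisted α) : braid α (ofA α a ⊗ₜ[k] y) =
    y ⊗ₜ[k] ofA α a - signedInt α y ⊗ₜ[k] (dg α).d (ofA α a) := by
  rw [braid_tmul α (ofA_mem α a)]; rfl

theorem braid_d_ofA (a : A) (y : Twisted α) : braid α ((dg α).d (ofA α a) ⊗ₜ[k] y) =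
    twist α y ⊗ₜ[k] (dg α).d (ofA α a) := by
  rw [braid_tmul α (d_ofA_mem α a), (dg α).d_d, TensorProduct.tmul_zero, sub_zero, pow_one]

theorem braid_ofA_ofA (a b : A) :
    braid α (ofA α a ⊗ₜ[k] ofA α b) = ofA α b ⊗ₜ[k] ofA α a := by
  rw [braid_ofA, signedInt_ofA, TensorProduct.zero_tmul, sub_zero]

theorem map_twist {α : A →ₐ[k] A} {β : B →ₐ[k] B} (f : A →ₐ[k] B) (hf : f.comp α = β.comp f)
    (x : Twisted α) : map f hf (twist α x) = twist β (map f hf x) := by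
  rw [twist_apply, map_sgn, map_bar]; rfl

theorem map_twist_pow {α : A →ₐ[k] A} {β : B →ₐ[k] B} (f : A →ₐ[k] B)
    (hf : f.comp α = β.comp f) (n : ℕ) (x : Twisted α) :
    map f hf ((twist α ^ n) x) = (twist β ^ n) (map f hf x) := by
  induction n with
  | zero => simp
  | succ n ih => rw [pow_succ', AlgHom.mul_apply, map_twist, ih, pow_succ', AlgHom.mul_apply]

theorem map_braid {α : A →ₐ[k] A} {β : B →ₐ[k] B} (f : A →ₐ[k] B) (hf : f.comp α = β.comp f) :
    TensorProduct.map (map f hf).toLinearMap (map f hf).toLinearMap ∘ₗ braid α =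
      braid β ∘ₗ TensorProduct.map (map f hf).toLinearMap (map f hf).toLinearMap := by
  refine (dg α).tensor_ext fun m x hx n y hy => ?_
  simp only [LinearMap.comp_apply, braid_tmul α hx, TensorProduct.map_tmul, AlgHom.toLinearMap_apply,
    braid_tmul β (map_mem f hf hx), map_sub, map_twist_pow, map_d, signedInt_apply, map_int,
    map_sgn]

/-- The power of `twist` contributes `(-1) ^ (p * q)`, and the sign hidden in `signedInt` a further
`(-1) ^ q`. -/
theorem braid_eq_int {p q : ℕ} {x y : Twisted α} (hx : x ∈ (dg α).deg p)
    (hy : y ∈ (dg α).deg q) : braid α (x ⊗ₜ[k] y) =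
      (-1 : k) ^ (p * q) • (((bar α)^[p] y) ⊗ₜ[k] x) -
        (-1 : k) ^ ((p + 1) * q) • (int α ((bar α)^[p] y) ⊗ₜ[k] (dg α).d x) := by
  have h := (twistedComm α).θ_pow_mem p hy
  change (twist α ^ p) y ∈ _ at h
  rw [braid_tmul α hx, signedInt_apply, (dg α).sgn_of_mem h, twist_pow_mem α p hy, smul_smul,
    ← pow_add, map_smul, TensorProduct.smul_tmul', TensorProduct.smul_tmul', add_one_mul, add_comm]

theorem dprod_nil : dprod α [] = 1 := rfl

theorem dprod_cons (a : A) (l : List A) :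
    dprod α (a :: l) = (dg α).d (ofA α a) * dprod α l := by
  simp [dprod]

/-- The prefix `x` is arbitrary so that the head `da` of the list can be absorbed into it; the sign
of `da` then produces the alternation. -/
theorem int_mul_dprod {x : Twisted α} (l : List A) : int α (x * dprod α l) =
    int α x * dprod α (l.map α) + (dg α).sgn x * ∑ i : Fin l.length, (-1 : k) ^ (i : ℕ) •
      (dprod α (l.take i) * ofA α (l.get i - α (l.get i)) * dprod α ((l.drop (i + 1)).map α)) := by
  induction l generalizing x with
  | nil => simp [dprod_nil]
  | cons a l ih =>
    rw [dprod_cons, ← mul_assoc, ih, int_mul, int_d_ofA, (dg α).sgn_mul,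
      (dg α).sgn_of_mem (d_ofA_mem α a), bar_d, bar_ofA, List.map_cons, dprod_cons,
      add_mul, add_assoc, mul_assoc]
    congr 1
    simp only [List.length_cons]
    rw [Fin.sum_univ_succ, mul_add]
    congr 1
    · simp [dprod_nil, mul_assoc]
    · rw [Finset.mul_sum, Finset.mul_sum]
      refine Finset.sum_congr rfl fun i _ => ?_
      simp [dprod_cons, pow_succ, mul_assoc]

theorem int_isIntegration : IsIntegration α (int α) where
  map_deg_zero _ hx := int_deg_zero α hx
  map_deg_succ _ _ hx := int_deg_succ α hx
  formula u l := by
    rw [int_mul_dprod, int_ofA, zero_mul, zero_add, (dg α).sgn_of_mem (ofA_mem α u), pow_zero,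
      one_smul, Finset.mul_sum]
    simp only [mul_smul_comm, mul_assoc]

end Twisted

end TwistedI

/-! ### Multiplication rules of a braiding -/

section BraidingRules

variable {k : Type*} [CommRing k] {B : Type*} [Ring B] [Algebra k B]
  {R : B ⊗[k] B →ₗ[k] B ⊗[k] B}

theorem mul12_tmul_left (x : B) (t : B ⊗[k] B) : mul12 k B (x ⊗ₜ[k] t) = (x ⊗ₜ[k] 1) * t := by
  induction t using TensorProduct.induction_on with
  | zero => simp
  | tmul y z => simp
  | add s t hs ht => rw [TensorProduct.tmul_add, map_add, hs, ht, mul_add]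

theorem mul23_assoc_tmul (t : B ⊗[k] B) (z : B) :
    mul23 k B (TensorProduct.assoc k B B B (t ⊗ₜ[k] z)) = t * (1 ⊗ₜ[k] z) := by
  induction t using TensorProduct.induction_on with
  | zero => simp
  | tmul x y => simp
  | add s t hs ht => rw [TensorProduct.add_tmul, map_add, map_add, hs, ht, add_mul]

theorem IsBraiding.apply_mul_right (h : IsBraiding R) (x y z : B) : R (x ⊗ₜ[k] (y * z)) =
    mul12 k B (on23 R (TensorProduct.assoc k B B B (R (x ⊗ₜ[k] y) ⊗ₜ[k] z))) :=
  (LinearMap.congr_fun h.compat_right (x ⊗ₜ[k] (y ⊗ₜ[k] z))).symm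

theorem IsBraiding.apply_mul_left (h : IsBraiding R) (x y z : B) : R ((x * y) ⊗ₜ[k] z) =
    mul23 k B (on12 R (x ⊗ₜ[k] R (y ⊗ₜ[k] z))) :=
  (LinearMap.congr_fun h.compat_left (x ⊗ₜ[k] (y ⊗ₜ[k] z))).symm

theorem on12_congr {R' : B ⊗[k] B →ₗ[k] B ⊗[k] B} {x : B}
    (h : ∀ y, R (x ⊗ₜ[k] y) = R' (x ⊗ₜ[k] y)) (t : B ⊗[k] B) :
    on12 R (x ⊗ₜ[k] t) = on12 R' (x ⊗ₜ[k] t) := by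
  induction t using TensorProduct.induction_on with
  | zero => simp
  | tmul y z => simp [h]
  | add s t hs ht => rw [TensorProduct.tmul_add, map_add, map_add, hs, ht]

end BraidingRules

namespace Twisted

section

variable {k : Type*} [CommRing k] {A : Type*} [CommRing A] [Algebra k A]
  {B : Type*} [CommRing B] [Algebra k B]

/-! ### Reduction of a braiding to its values on `dA ⊗ A` -/

section Determination

variable {α : A →ₐ[k] A} {R : Twisted α ⊗[k] Twisted α →ₗ[k] Twisted α ⊗[k] Twisted α}

/-- Apply `R` to the differential of `a ⊗ b`, and compare with the differential of `b ⊗ a`. -/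
theorem apply_ofA_d_ofA (h : (dg α).IsDGBraiding R)
    (flip : ∀ a b, R (ofA α a ⊗ₜ[k] ofA α b) = ofA α b ⊗ₜ[k] ofA α a) (a b : A) :
    R (ofA α a ⊗ₜ[k] (dg α).d (ofA α b)) = (dg α).d (ofA α b) ⊗ₜ[k] ofA α a +
      ofA α b ⊗ₜ[k] (dg α).d (ofA α a) - R ((dg α).d (ofA α a) ⊗ₜ[k] ofA α b) := by
  have h1 := LinearMap.congr_fun h.comm_d (ofA α a ⊗ₜ[k] ofA α b)
  rw [LinearMap.comp_apply, LinearMap.comp_apply, flip, (dg α).tensorD_tmul (ofA_mem α a),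
    (dg α).tensorD_tmul (ofA_mem α b), pow_zero, one_smul, one_smul, map_add] at h1
  rw [← h1]; abel

/-- A braiding of twisted forms is determined by its values on `dA ⊗ A`. -/
theorem eq_braid_of_apply_d_ofA (h : (dg α).IsDGBraiding R)
    (flip : ∀ a b, R (ofA α a ⊗ₜ[k] ofA α b) = ofA α b ⊗ₜ[k] ofA α a)
    (hd : ∀ a b, R ((dg α).d (ofA α a) ⊗ₜ[k] ofA α b) =
      ofA α (α b) ⊗ₜ[k] (dg α).d (ofA α a)) : R = braid α := by
  have h0 := (braid_isDGBraiding α).toIsBraiding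
  have h1 : ∀ a b, R (ofA α a ⊗ₜ[k] (dg α).d (ofA α b)) = (dg α).d (ofA α b) ⊗ₜ[k] ofA α a +
      ofA α (b - α b) ⊗ₜ[k] (dg α).d (ofA α a) := fun a b => by
    rw [apply_ofA_d_ofA h flip, hd, map_sub, TensorProduct.sub_tmul]; abel
  -- The differential of `a ⊗ db` is `da ⊗ db`, so this value follows from the previous one.
  have h2 : ∀ a b, R ((dg α).d (ofA α a) ⊗ₜ[k] (dg α).d (ofA α b)) =
      -((dg α).d (ofA α (α b)) ⊗ₜ[k] (dg α).d (ofA α a)) := fun a b => by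
    have e := LinearMap.congr_fun h.comm_d (ofA α a ⊗ₜ[k] (dg α).d (ofA α b))
    rw [LinearMap.comp_apply, LinearMap.comp_apply, h1, (dg α).tensorD_tmul (ofA_mem α a),
      map_add (dg α).tensorD, (dg α).tensorD_tmul (d_ofA_mem α b),
      (dg α).tensorD_tmul (ofA_mem α _), (dg α).d_d, (dg α).d_d] at e
    simp only [TensorProduct.tmul_zero, smul_zero, add_zero, TensorProduct.zero_tmul, zero_add,
      map_sub, TensorProduct.sub_tmul] at e
    rw [e]; simp only [pow_one, neg_smul, one_smul]; abel
  -- Left arguments `a` and `da` are handled together: passing `a` across a form leaves both `a` and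
  -- `da` on its right.
  have key : ∀ y, (∀ a, R (ofA α a ⊗ₜ[k] y) = braid α (ofA α a ⊗ₜ[k] y)) ∧
      ∀ a, R ((dg α).d (ofA α a) ⊗ₜ[k] y) = braid α ((dg α).d (ofA α a) ⊗ₜ[k] y) := by
    intro y
    induction y using induction_gen with
    | add x y hx hy =>
      exact ⟨fun a => by rw [TensorProduct.tmul_add, map_add, map_add, hx.1, hy.1],
        fun a => by rw [TensorProduct.tmul_add, map_add, map_add, hx.2, hy.2]⟩
    | mul x y hx hy =>
      refine ⟨fun a => ?_, fun a => ?_⟩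
      · rw [h.apply_mul_right, h0.apply_mul_right, hx.1, braid_ofA]
        simp only [TensorProduct.sub_tmul, TensorProduct.assoc_tmul, map_sub, on23_tmul, hy.1, hy.2]
      · rw [h.apply_mul_right, h0.apply_mul_right, hx.2, braid_d_ofA]
        simp only [TensorProduct.assoc_tmul, on23_tmul, hy.2]
    | ofA b => exact ⟨fun a => by rw [flip, braid_ofA_ofA],
        fun a => by rw [hd, braid_d_ofA, twist_ofA]⟩
    | d b => exact ⟨fun a => by rw [h1, braid_ofA, signedInt_d_ofA, TensorProduct.neg_tmul,
          sub_neg_eq_add],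
        fun a => by rw [h2, braid_d_ofA, twist_d_ofA, TensorProduct.neg_tmul]⟩
  -- With generators on the left settled for every right argument, `compat_left` extends the
  -- equality to all left arguments.
  refine TensorProduct.ext (LinearMap.ext fun x => LinearMap.ext fun z => ?_)
  change R (x ⊗ₜ[k] z) = braid α (x ⊗ₜ[k] z)
  induction x using induction_gen generalizing z with
  | add x y hx hy => rw [TensorProduct.add_tmul, map_add, map_add, hx, hy]
  | mul x y hx hy => rw [h.apply_mul_left, h0.apply_mul_left, hy, on12_congr hx]
  | ofA a => exact (key z).1 a
  | d a => exact (key z).2 a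

end Determination

/-! ### Forms of degree zero and one -/

variable (α : A →ₐ[k] A)

/-- The projection from universal forms to functions. -/
def preAug : Univ k A →ₐ[k] A := Univ.lift (AlgHom.id k A) 0 (by simp) (by simp)

theorem preAug_inA (a : A) : preAug (Univ.inA k A a) = a := Univ.lift_inA _ _ _ _ a

theorem preAug_d (x : Univ k A) : preAug (Univ.d k A x) = 0 := by
  induction x using (univDG k A).induction_deg with
  | hadd x y hx hy => rw [map_add, map_add, hx, hy, add_zero]
  | h n x hx =>
    refine Univ.induction_mul_d (P := fun n x => preAug (Univ.d k A x) = 0) ?_ ?_ ?_ hx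
    · intro n x y hx hy; rw [map_add, map_add, hx, hy, add_zero]
    · intro a; rw [Univ.d_inA]; exact Univ.lift_inΩ _ _ _ _ _
    · intro n x hx a h
      rw [Univ.d_mul k hx, map_add, map_mul, h, zero_mul, Univ.d_inΩ, Univ.dΩ_univD]
      simp

/-- The projection from twisted forms to functions. -/
def aug : Twisted α →ₐ[k] A :=
  Ideal.Quotient.liftₐ _ preAug (by
    intro x hx
    refine RingHom.mem_ker.1 ((univDG k A).mem_diffIdeal.1 hx (RingHom.ker preAug) inferInstance
      (fun y _ => RingHom.mem_ker.2 (preAug_d y)) ?_)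
    rintro _ ⟨a, b, rfl⟩
    refine RingHom.mem_ker.2 ?_
    rw [map_sub, map_mul, map_mul, preAug_d, zero_mul, mul_zero, sub_zero])

theorem aug_ofA (a : A) : aug α (ofA α a) = a := preAug_inA a

theorem aug_d (x : Twisted α) : aug α ((dg α).d x) = 0 := by
  obtain ⟨x, rfl⟩ := proj_surjective α x
  exact preAug_d x

theorem aug_map {α : A →ₐ[k] A} {β : B →ₐ[k] B} (f : A →ₐ[k] B) (hf : f.comp α = β.comp f)
    (x : Twisted α) : aug β (map f hf x) = f (aug α x) := by
  induction x using induction_gen with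
  | add x y hx hy => simp only [map_add, hx, hy]
  | mul x y hx hy => simp only [map_mul, hx, hy]
  | ofA a => rw [map_ofA, aug_ofA, aug_ofA]
  | d a => rw [map_d, aug_d, aug_d, map_zero]

variable {α} in
theorem exists_of_mem_deg_zero {x : Twisted α} (hx : x ∈ (dg α).deg 0) : ∃ a, x = ofA α a := by
  refine induction_mul_d (P := fun n x => n = 0 → ∃ a, x = ofA α a) ?_ ?_ ?_ hx rfl
  · intro n x y hx hy h
    obtain ⟨a, rfl⟩ := hx h
    obtain ⟨b, rfl⟩ := hy h
    exact ⟨a + b, (map_add _ _ _).symm⟩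
  · exact fun a _ => ⟨a, rfl⟩
  · intro n x hx a _ h; omega

variable {α} in
theorem induction_deg_one {P : Twisted α → Prop} (add : ∀ x y, P x → P y → P (x + y))
    (mul_d : ∀ a b, P (ofA α a * (dg α).d (ofA α b))) {x : Twisted α}
    (hx : x ∈ (dg α).deg 1) : P x := by
  refine induction_mul_d (P := fun n x => n = 1 → P x) ?_ ?_ ?_ hx rfl
  · exact fun n x y hx hy h => add x y (hx h) (hy h)
  · intro a h; omega
  · intro n x hx b _ h
    obtain rfl : n = 0 := by omega
    obtain ⟨a, rfl⟩ := exists_of_mem_deg_zero hx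
    exact mul_d a b

/-- Integration followed by the projection to functions. -/
def intAug : Twisted α →ₗ[k] A := (aug α).toLinearMap ∘ₗ int α

theorem intAug_apply (x : Twisted α) : intAug α x = aug α (int α x) := rfl

theorem intAug_d_ofA (a : A) : intAug α ((dg α).d (ofA α a)) = a - α a := by
  rw [intAug_apply, int_d_ofA, aug_ofA]

theorem intAug_mul_ofA (x : Twisted α) (a : A) :
    intAug α (x * ofA α a) = α a * intAug α x := by
  rw [intAug_apply, int_mul, int_ofA, mul_zero, add_zero, map_mul, bar_ofA, aug_ofA, mul_comm]; rfl

theorem intAug_ofA_mul (a : A) (x : Twisted α) :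
    intAug α (ofA α a * x) = a * intAug α x := by
  rw [intAug_apply, int_mul, int_ofA, zero_mul, zero_add, map_mul,
    (dg α).sgn_of_mem (ofA_mem α a), pow_zero, one_smul, aug_ofA]; rfl

theorem intAug_map {α : A →ₐ[k] A} {β : B →ₐ[k] B} (f : A →ₐ[k] B) (hf : f.comp α = β.comp f)
    (x : Twisted α) : intAug β (map f hf x) = f (intAug α x) := by
  rw [intAug_apply, ← map_int, aug_map]; rfl

/-- The tensors in `Ω⁰ ⊗ Ω¹`. -/
def tensorZeroOne : Submodule k (Twisted α ⊗[k] Twisted α) :=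
  Submodule.span k {t | ∃ a, ∃ x ∈ (dg α).deg 1, t = ofA α a ⊗ₜ[k] x}

-- A tensor of degree one has parts in `Ω⁰ ⊗ Ω¹` and `Ω¹ ⊗ Ω⁰`. The map in the hypothesis isolates
-- the second part, with its right factor read in `A`.
variable {α} in
theorem mem_tensorZeroOne {t : Twisted α ⊗[k] Twisted α} (ht : t ∈ (dg α).tensorDeg 1)
    (h : TensorProduct.map ((dg α).comp 1) (aug α).toLinearMap t = 0) : t ∈ tensorZeroOne α := by
  -- The subtracted term is the `Ω¹ ⊗ Ω⁰` part of `t`, which makes the claim linear in `t`.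
  suffices H : t - TensorProduct.map LinearMap.id (ofA α).toLinearMap
      (TensorProduct.map ((dg α).comp 1) (aug α).toLinearMap t) ∈ tensorZeroOne α by
    rwa [h, map_zero, sub_zero] at H
  clear h
  induction ht using Submodule.span_induction with
  | zero => simp
  | add x y _ _ hx hy =>
    simp only [map_add]; rw [add_sub_add_comm]; exact add_mem hx hy
  | smul c x _ hx =>
    simp only [map_smul]; rw [← smul_sub]; exact Submodule.smul_mem _ _ hx
  | mem t ht =>
    obtain ⟨p, q, hpq, x, hx, y, hy, rfl⟩ := ht
    rw [TensorProduct.map_tmul, TensorProduct.map_tmul, (dg α).comp_of_mem hx]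
    obtain ⟨rfl, rfl⟩ | ⟨rfl, rfl⟩ : (p = 0 ∧ q = 1) ∨ (p = 1 ∧ q = 0) := by omega
    · obtain ⟨a, rfl⟩ := exists_of_mem_deg_zero hx
      have h : ofA α a ⊗ₜ[k] y ∈ tensorZeroOne α := Submodule.subset_span ⟨a, y, hy, rfl⟩
      simpa using h
    · obtain ⟨a, rfl⟩ := exists_of_mem_deg_zero hy
      simp [aug_ofA]

/-- The map `Ω ⊗ Ω → A ⊗ A` induced by the projection to functions on the left factor and by
integration on the right one. -/
def tensorInt : Twisted α ⊗[k] Twisted α →ₗ[k] A ⊗[k] A :=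
  TensorProduct.map (aug α).toLinearMap (intAug α)

theorem tensorInt_tmul (x y : Twisted α) :
    tensorInt α (x ⊗ₜ[k] y) = aug α x ⊗ₜ[k] intAug α y := rfl

theorem tensorInt_mul_left (a : A) (t : Twisted α ⊗[k] Twisted α) :
    tensorInt α ((ofA α a ⊗ₜ[k] 1) * t) = (a ⊗ₜ[k] 1) * tensorInt α t := by
  induction t using TensorProduct.induction_on with
  | zero => simp
  | tmul x y => simp [tensorInt_tmul, aug_ofA]
  | add s t hs ht => simp only [mul_add, map_add, hs, ht]

theorem tensorInt_mul_right (t : Twisted α ⊗[k] Twisted α) (a : A) :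
    tensorInt α (t * (1 ⊗ₜ[k] ofA α a)) = (1 ⊗ₜ[k] α a) * tensorInt α t := by
  induction t using TensorProduct.induction_on with
  | zero => simp
  | tmul x y => simp [tensorInt_tmul, intAug_mul_ofA]
  | add s t hs ht => simp only [mul_add, add_mul, map_add, hs, ht]

theorem tensorInt_map {α : A →ₐ[k] A} {β : B →ₐ[k] B} (f : A →ₐ[k] B)
    (hf : f.comp α = β.comp f) (t : Twisted α ⊗[k] Twisted α) :
    tensorInt β (TensorProduct.map (map f hf).toLinearMap (map f hf).toLinearMap t) =
      Algebra.TensorProduct.map f f (tensorInt α t) := by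
  induction t using TensorProduct.induction_on with
  | zero => simp
  | tmul x y => simp [tensorInt_tmul, aug_map, intAug_map]
  | add s t hs ht => simp only [map_add, hs, ht]

variable {α} in
theorem intAug_mul_of_mem_tensorZeroOne {t : Twisted α ⊗[k] Twisted α}
    (ht : t ∈ tensorZeroOne α) : intAug α (LinearMap.mul' k _ t) =
      Algebra.TensorProduct.lmul' k (S := A) (tensorInt α t) := by
  induction ht using Submodule.span_induction with
  | zero => simp
  | add x y _ _ hx hy => simp only [map_add, hx, hy]
  | smul c x _ hx => simp only [map_smul, hx]
  | mem t ht =>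
    obtain ⟨a, x, hx, rfl⟩ := ht
    simp [tensorInt_tmul, intAug_ofA_mul, aug_ofA]

end

/-! ### Relations satisfied by the deviation -/

section Relations

variable {k : Type*} [CommRing k] {A : Type*} [CommRing A] [Algebra k A]
  {α : A →ₐ[k] A} {R : Twisted α ⊗[k] Twisted α →ₗ[k] Twisted α ⊗[k] Twisted α}

theorem apply_mul_ofA (h : IsBraiding R)
    (flip : ∀ a b, R (ofA α a ⊗ₜ[k] ofA α b) = ofA α b ⊗ₜ[k] ofA α a) (x : Twisted α) (a b : A) :
    R ((x * ofA α a) ⊗ₜ[k] ofA α b) = R (x ⊗ₜ[k] ofA α b) * (1 ⊗ₜ[k] ofA α a) := by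
  rw [h.apply_mul_left, flip, on12_tmul, mul23_assoc_tmul]

theorem apply_ofA_ofA_mul (h : IsBraiding R)
    (flip : ∀ a b, R (ofA α a ⊗ₜ[k] ofA α b) = ofA α b ⊗ₜ[k] ofA α a) (a b : A) (x : Twisted α) :
    R (ofA α a ⊗ₜ[k] (ofA α b * x)) = (ofA α b ⊗ₜ[k] 1) * R (ofA α a ⊗ₜ[k] x) := by
  rw [h.apply_mul_right, flip, TensorProduct.assoc_tmul, on23_tmul, mul12_tmul_left]

/-- When `R(x ⊗ b)` lies in `Ω⁰ ⊗ Ω¹`, the factor `a` only has to cross functions, where `R` is the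
flip; it then multiplies the right factor. -/
theorem tensorInt_apply_ofA_mul (h : IsBraiding R)
    (flip : ∀ a b, R (ofA α a ⊗ₜ[k] ofA α b) = ofA α b ⊗ₜ[k] ofA α a) (a b : A) (x : Twisted α)
    (hx : R (x ⊗ₜ[k] ofA α b) ∈ tensorZeroOne α) :
    tensorInt α (R ((ofA α a * x) ⊗ₜ[k] ofA α b)) =
      (1 ⊗ₜ[k] a) * tensorInt α (R (x ⊗ₜ[k] ofA α b)) := by
  rw [h.apply_mul_left]
  generalize R (x ⊗ₜ[k] ofA α b) = T at hx ⊢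
  induction hx using Submodule.span_induction with
  | zero => simp
  | add x y _ _ hx hy => rw [TensorProduct.tmul_add]; simp only [map_add, hx, hy, mul_add]
  | smul c x _ hx => simp only [TensorProduct.tmul_smul, map_smul, hx, mul_smul_comm]
  | mem t ht =>
    obtain ⟨c, x, hx, rfl⟩ := ht
    rw [on12_tmul, flip, TensorProduct.assoc_tmul, mul23_tmul, tensorInt_tmul, tensorInt_tmul,
      intAug_ofA_mul]
    simp

/-- The deviation of `R (da ⊗ b)` from its expected value, as an element of `A ⊗ A`. -/
def deviation (R : Twisted α ⊗[k] Twisted α →ₗ[k] Twisted α ⊗[k] Twisted α) (a b : A) :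
    A ⊗[k] A :=
  tensorInt α (R ((dg α).d (ofA α a) ⊗ₜ[k] ofA α b)) - α b ⊗ₜ[k] (a - α a)

/-- Obtained by applying `R(x ⊗ -)` to `dy z = α(z) dy` and eliminating `R(x ⊗ dy)`. The left side
is not visibly symmetric in `y` and `z`, but the right side is. -/
theorem apply_d_ofA_mul (h : (dg α).IsDGBraiding R)
    (flip : ∀ a b, R (ofA α a ⊗ₜ[k] ofA α b) = ofA α b ⊗ₜ[k] ofA α a) (x y z : A) :
    (ofA α y ⊗ₜ[k] 1) * R ((dg α).d (ofA α x) ⊗ₜ[k] ofA α z) +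
        (ofA α (α z) ⊗ₜ[k] 1) * R ((dg α).d (ofA α x) ⊗ₜ[k] ofA α y) -
        (ofA α (α z) * ofA α y) ⊗ₜ[k] (dg α).d (ofA α x) =
      R ((dg α).d (ofA α x) ⊗ₜ[k] ofA α (y * z)) := by
  have h1 : R (ofA α x ⊗ₜ[k] ((dg α).d (ofA α y) * ofA α z)) =
      R (ofA α x ⊗ₜ[k] (ofA α (α z) * (dg α).d (ofA α y))) := by rw [d_ofA_mul_ofA]
  rw [apply_ofA_ofA_mul h.toIsBraiding flip, h.apply_mul_right, apply_ofA_d_ofA h flip,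
    TensorProduct.sub_tmul, TensorProduct.add_tmul, map_sub, map_add, map_sub, map_add, map_sub,
    map_add, TensorProduct.assoc_tmul, TensorProduct.assoc_tmul, on23_tmul, on23_tmul, flip,
    ← h.apply_mul_right, ← map_mul, mul12_tmul, mul12_tmul_left, d_ofA_mul_ofA, mul_sub, mul_add,
    Algebra.TensorProduct.tmul_mul_tmul, Algebra.TensorProduct.tmul_mul_tmul, one_mul, one_mul,
    add_sub_assoc, add_sub_assoc, add_right_inj] at h1
  rw [sub_eq_sub_iff_add_eq_add] at h1
  rw [h1]; abel

/-- The preceding formula for `yz` and for `zy`, compared after integration. -/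
theorem deviation_right_comm (h : (dg α).IsDGBraiding R)
    (flip : ∀ a b, R (ofA α a ⊗ₜ[k] ofA α b) = ofA α b ⊗ₜ[k] ofA α a) (x y z : A) :
    ((y - α y) ⊗ₜ[k] 1) * deviation R x z = ((z - α z) ⊗ₜ[k] 1) * deviation R x y := by
  have h1 := apply_d_ofA_mul h flip x y z
  rw [mul_comm y z, ← apply_d_ofA_mul h flip x z y] at h1
  have h2 := congrArg (tensorInt α) h1
  simp only [map_sub, map_add, tensorInt_mul_left, tensorInt_tmul, map_mul, aug_ofA,
    intAug_d_ofA] at h2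
  simp only [deviation, TensorProduct.sub_tmul, mul_sub, sub_mul, TensorProduct.tmul_sub,
    Algebra.TensorProduct.tmul_mul_tmul, one_mul] at h2 ⊢
  rw [mul_comm (α z) y, mul_comm (α y) z] at h2
  rw [mul_comm (α z) (α y)]
  linear_combination h2

/-- Same principle in the first argument: expand `d(x x')` and `d(x' x)`. -/
theorem deviation_left_comm (h : IsBraiding R)
    (flip : ∀ a b, R (ofA α a ⊗ₜ[k] ofA α b) = ofA α b ⊗ₜ[k] ofA α a)
    (hR : ∀ a b, R ((dg α).d (ofA α a) ⊗ₜ[k] ofA α b) ∈ tensorZeroOne α) (x x' y : A) :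
    (1 ⊗ₜ[k] (x' - α x')) * deviation R x y = (1 ⊗ₜ[k] (x - α x)) * deviation R x' y := by
  have key : ∀ a b : A, tensorInt α (R ((dg α).d (ofA α (a * b)) ⊗ₜ[k] ofA α y)) =
      (1 ⊗ₜ[k] α b) * tensorInt α (R ((dg α).d (ofA α a) ⊗ₜ[k] ofA α y)) +
      (1 ⊗ₜ[k] a) * tensorInt α (R ((dg α).d (ofA α b) ⊗ₜ[k] ofA α y)) := fun a b => by
    rw [d_ofA_mul, ← d_ofA_mul_ofA, TensorProduct.add_tmul, map_add, map_add,
      apply_mul_ofA h flip, tensorInt_mul_right, tensorInt_apply_ofA_mul h flip _ _ _ (hR b y)]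
  have h1 := key x x'
  rw [mul_comm x x', key x' x] at h1
  simp only [deviation, mul_sub, sub_mul, TensorProduct.tmul_sub,
    Algebra.TensorProduct.tmul_mul_tmul, one_mul] at h1 ⊢
  simp only [mul_comm x' x, mul_comm x' (α x), mul_comm (α x') x, mul_comm (α x') (α x)]
  linear_combination h1

/-- By `μ R = μ`, the product of `R(dx ⊗ y)` is `dx y = α(y) dx`, whose integral is `α(y) (x - α
x)`. -/
theorem lmul_deviation (h : IsBraiding R)
    (hR : ∀ a b, R ((dg α).d (ofA α a) ⊗ₜ[k] ofA α b) ∈ tensorZeroOne α) (x y : A) :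
    Algebra.TensorProduct.lmul' k (S := A) (deviation R x y) = 0 := by
  have h1 := LinearMap.congr_fun h.mul_comp ((dg α).d (ofA α x) ⊗ₜ[k] ofA α y)
  rw [LinearMap.comp_apply, LinearMap.mul'_apply, d_ofA_mul_ofA] at h1
  rw [deviation, map_sub, ← intAug_mul_of_mem_tensorZeroOne (hR x y), h1, intAug_ofA_mul,
    intAug_d_ofA, Algebra.TensorProduct.lmul'_apply_tmul, sub_self]

/-- In presence of a function `t` with `α t = 0` that is cancellable, `R` maps `dA ⊗ A` to
`Ω⁰ ⊗ Ω¹`. -/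
theorem apply_d_ofA_mem (h : (dg α).IsDGBraiding R)
    (flip : ∀ a b, R (ofA α a ⊗ₜ[k] ofA α b) = ofA α b ⊗ₜ[k] ofA α a) {t : A} (ht : α t = 0)
    (δ : A →ₗ[k] A) (hδ : ∀ a, δ (t * a) = a) (a b : A) :
    R ((dg α).d (ofA α a) ⊗ₜ[k] ofA α b) ∈ tensorZeroOne α := by
  refine mem_tensorZeroOne (h.map_deg 1 _ (Submodule.subset_span
    ⟨1, 0, rfl, _, d_ofA_mem α a, _, ofA_mem α b, rfl⟩)) ?_
  -- Since `da t = α(t) da = 0`, right multiplication by `1 ⊗ t` annihilates `R(da ⊗ b)`; below, `δ`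
  -- undoes this multiplication once the right factor is projected to functions.
  have h1 := apply_mul_ofA h.toIsBraiding flip ((dg α).d (ofA α a)) t b
  rw [d_ofA_mul_ofA, ht, map_zero, zero_mul, TensorProduct.zero_tmul, map_zero] at h1
  generalize R ((dg α).d (ofA α a) ⊗ₜ[k] ofA α b) = T at h1 ⊢
  have h2 : TensorProduct.map ((dg α).comp 1) (δ ∘ₗ (aug α).toLinearMap)
      (T * (1 ⊗ₜ[k] ofA α t)) = TensorProduct.map ((dg α).comp 1) (aug α).toLinearMap T := by
    clear h1
    induction T using TensorProduct.induction_on with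
    | zero => simp
    | tmul x y => simp [aug_ofA, mul_comm _ t, hδ]
    | add s t hs ht => simp only [add_mul, map_add, hs, ht]
  rw [← h2, ← h1, map_zero]

end Relations

/-! ### Polynomial algebras with a generic endomorphism -/

section Polynomial

variable {k : Type*} [CommRing k] {σ : Type*} (ν : σ → σ)

variable (k) in
/-- The endomorphism `X s ↦ X s - X (ν s)` of a polynomial algebra. -/
def polyEnd : MvPolynomial σ k →ₐ[k] MvPolynomial σ k :=
  MvPolynomial.aeval fun s => MvPolynomial.X s - MvPolynomial.X (ν s)

theorem polyEnd_X (s : σ) :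
    polyEnd k ν (MvPolynomial.X s) = MvPolynomial.X s - MvPolynomial.X (ν s) :=
  MvPolynomial.aeval_X _ _

theorem sub_polyEnd_X (s : σ) : (MvPolynomial.X s : MvPolynomial σ k) -
    polyEnd k ν (MvPolynomial.X s) = MvPolynomial.X (ν s) := by
  rw [polyEnd_X, sub_sub_cancel]

open Classical in
variable (k) in
/-- A `k`-linear map from functions to one-forms that inverts integration. -/
def primitive : MvPolynomial σ k →ₗ[k] Twisted (polyEnd k ν) :=
  (MvPolynomial.basisMonomials σ k).constr k fun m =>
    if h : ∃ s, m (ν s) ≠ 0 then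
      ofA (polyEnd k ν) (MvPolynomial.monomial (m - Finsupp.single (ν h.choose) 1) 1) *
        (dg (polyEnd k ν)).d (ofA (polyEnd k ν) (MvPolynomial.X h.choose))
    else 0

open Classical in
theorem primitive_monomial (m : σ →₀ ℕ) : primitive k ν (MvPolynomial.monomial m 1) =
    if h : ∃ s, m (ν s) ≠ 0 then
      ofA (polyEnd k ν) (MvPolynomial.monomial (m - Finsupp.single (ν h.choose) 1) 1) *
        (dg (polyEnd k ν)).d (ofA (polyEnd k ν) (MvPolynomial.X h.choose))
    else 0 := by
  have := (MvPolynomial.basisMonomials σ k).constr_basis k (fun m =>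
    if h : ∃ s, m (ν s) ≠ 0 then
      ofA (polyEnd k ν) (MvPolynomial.monomial (m - Finsupp.single (ν h.choose) 1) 1) *
        (dg (polyEnd k ν)).d (ofA (polyEnd k ν) (MvPolynomial.X h.choose))
    else 0) m
  rwa [MvPolynomial.coe_basisMonomials] at this

variable {ν}

/-- The definition selects some variable `X (ν s')` dividing the monomial. Selecting another one
gives the same form by `sub_mul_d_comm`, because `X s - α (X s) = X (ν s)`. -/
theorem primitive_mul_X (hν : Function.Injective ν) (f : MvPolynomial σ k) (s : σ) :
    primitive k ν (f * MvPolynomial.X (ν s)) = ofA (polyEnd k ν) f *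
      (dg (polyEnd k ν)).d (ofA (polyEnd k ν) (MvPolynomial.X s)) := by
  classical
  have key : ∀ m : σ →₀ ℕ, primitive k ν (MvPolynomial.monomial m 1 * MvPolynomial.X (ν s)) =
      ofA (polyEnd k ν) (MvPolynomial.monomial m 1) *
        (dg (polyEnd k ν)).d (ofA (polyEnd k ν) (MvPolynomial.X s)) := by
    intro m
    have hm : (MvPolynomial.monomial m 1 * MvPolynomial.X (ν s) : MvPolynomial σ k) =
        MvPolynomial.monomial (m + Finsupp.single (ν s) 1) 1 := by
      rw [MvPolynomial.X, MvPolynomial.monomial_mul, one_mul]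
    have hex : ∃ s', (m + Finsupp.single (ν s) 1 : σ →₀ ℕ) (ν s') ≠ 0 := ⟨s, by simp⟩
    rw [hm, primitive_monomial, dif_pos hex]
    have hs := hex.choose_spec
    generalize hex.choose = s' at hs ⊢
    by_cases e : s' = s
    · rw [e, add_tsub_cancel_right]
    -- By injectivity of `ν` the selected variable differs from `X (ν s)`, so it divides `m`.
    · have e' : ν s ≠ ν s' := fun h => e (hν h).symm
      rw [Finsupp.add_apply, Finsupp.single_eq_of_ne e'.symm, add_zero] at hs
      obtain ⟨m', rfl⟩ : ∃ m', m = m' + Finsupp.single (ν s') 1 :=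
        ⟨m - Finsupp.single (ν s') 1, (tsub_add_cancel_of_le
          (Finsupp.single_le_iff.2 (Nat.one_le_iff_ne_zero.2 hs))).symm⟩
      have hX : ∀ r : σ, (MvPolynomial.monomial (m' + Finsupp.single r 1) 1 : MvPolynomial σ k) =
          MvPolynomial.monomial m' 1 * MvPolynomial.X r := fun r => by
        rw [MvPolynomial.X, MvPolynomial.monomial_mul, one_mul]
      have hc := sub_mul_d_comm (polyEnd k ν) (MvPolynomial.X s) (MvPolynomial.X s')
      rw [sub_polyEnd_X, sub_polyEnd_X] at hc
      rw [add_right_comm, add_tsub_cancel_right, hX, hX, map_mul, map_mul, mul_assoc, mul_assoc, hc]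
  induction f using MvPolynomial.induction_on' with
  | monomial m c =>
    have hc : (MvPolynomial.monomial m c : MvPolynomial σ k) = c • MvPolynomial.monomial m 1 := by
      rw [MvPolynomial.smul_monomial, smul_eq_mul, mul_one]
    rw [hc, smul_mul_assoc, map_smul, key, map_smul, smul_mul_assoc]
  | add f g hf hg => rw [add_mul, map_add, hf, hg, map_add, add_mul]

/-- Induction on `g`: the splitting of `gX - α(gX)` into `α(X) (g - α g)` and `g (X - α X)` mirrors
the expansion `d_ofA_mul` of `d(gX)`. -/
theorem primitive_mul_sub (hν : Function.Injective ν) (f g : MvPolynomial σ k) :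
    primitive k ν (f * (g - polyEnd k ν g)) = ofA (polyEnd k ν) f *
      (dg (polyEnd k ν)).d (ofA (polyEnd k ν) g) := by
  induction g using MvPolynomial.induction_on generalizing f with
  | C c =>
    have hc : (MvPolynomial.C c : MvPolynomial σ k) = algebraMap k _ c := rfl
    have hd : (dg (polyEnd k ν)).d (algebraMap k (Twisted (polyEnd k ν)) c) = 0 := by
      rw [Algebra.algebraMap_eq_smul_one, map_smul, DGStructure.d_one, smul_zero]
    rw [hc, AlgHom.commutes, sub_self, mul_zero, map_zero, AlgHom.commutes, hd, mul_zero]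
  | add g h hg hh =>
    rw [map_add (ofA _), map_add (dg _).d, mul_add, ← hg, ← hh, ← map_add, map_add]
    congr 1; ring
  | mul_X g s hg =>
    have e : f * (g * MvPolynomial.X s - polyEnd k ν (g * MvPolynomial.X s)) =
        f * polyEnd k ν (MvPolynomial.X s) * (g - polyEnd k ν g) +
          f * g * MvPolynomial.X (ν s) := by
      rw [← sub_polyEnd_X, map_mul]; ring
    rw [e, map_add, hg, primitive_mul_X hν, d_ofA_mul, map_mul, map_mul, mul_add, mul_assoc,
      mul_assoc]

theorem primitive_intAug (hν : Function.Injective ν) {x : Twisted (polyEnd k ν)}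
    (hx : x ∈ (dg (polyEnd k ν)).deg 1) : primitive k ν (intAug (polyEnd k ν) x) = x := by
  refine induction_deg_one (P := fun x => primitive k ν (intAug (polyEnd k ν) x) = x) ?_ ?_ hx
  · intro x y hx hy; rw [map_add, map_add, hx, hy]
  · intro f g; rw [intAug_ofA_mul, intAug_d_ofA, primitive_mul_sub hν]

/-- Integration is injective on `Ω⁰ ⊗ Ω¹`. -/
theorem map_primitive_tensorInt (hν : Function.Injective ν)
    {t : Twisted (polyEnd k ν) ⊗[k] Twisted (polyEnd k ν)}
    (ht : t ∈ tensorZeroOne (polyEnd k ν)) :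
    TensorProduct.map (ofA (polyEnd k ν)).toLinearMap (primitive k ν)
      (tensorInt (polyEnd k ν) t) = t := by
  induction ht using Submodule.span_induction with
  | zero => simp
  | add x y _ _ hx hy => simp only [map_add, hx, hy]
  | smul c x _ hx => simp only [map_smul, hx]
  | mem t ht =>
    obtain ⟨a, x, hx, rfl⟩ := ht
    rw [tensorInt_tmul, TensorProduct.map_tmul, primitive_intAug hν hx, aug_ofA]; rfl

/-- A linear left inverse is stronger than cancellability: it survives tensoring with an arbitrary
module. -/
theorem exists_leftInverse_mul_X (s : σ) :
    ∃ δ : MvPolynomial σ k →ₗ[k] MvPolynomial σ k, ∀ f, δ (MvPolynomial.X s * f) = f :=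
  ⟨{ toFun := fun f => f.divMonomial (Finsupp.single s 1)
     map_add' := fun f g => MvPolynomial.add_divMonomial f g _
     map_smul' := fun c f => by
       ext m; simp [MvPolynomial.coeff_divMonomial] },
   fun f => MvPolynomial.X_mul_divMonomial s f⟩

end Polynomial

/-! ### Vanishing of the deviation for generic variables -/

theorem deviation_map {k : Type*} [CommRing k] {A : Type*} [CommRing A] [Algebra k A]
    {B : Type*} [CommRing B] [Algebra k B] {α : A →ₐ[k] A} {β : B →ₐ[k] B}
    {R : Twisted α ⊗[k] Twisted α →ₗ[k] Twisted α ⊗[k] Twisted α}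
    {S : Twisted β ⊗[k] Twisted β →ₗ[k] Twisted β ⊗[k] Twisted β}
    (f : A →ₐ[k] B) (hf : f.comp α = β.comp f)
    (nat : TensorProduct.map (map f hf).toLinearMap (map f hf).toLinearMap ∘ₗ R =
      S ∘ₗ TensorProduct.map (map f hf).toLinearMap (map f hf).toLinearMap) (a b : A) :
    Algebra.TensorProduct.map f f (deviation R a b) = deviation S (f a) (f b) := by
  have h := LinearMap.congr_fun nat ((dg α).d (ofA α a) ⊗ₜ[k] ofA α b)
  rw [LinearMap.comp_apply, LinearMap.comp_apply, TensorProduct.map_tmul, AlgHom.toLinearMap_apply,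
    AlgHom.toLinearMap_apply, map_d, map_ofA, map_ofA] at h
  have hb : f (α b) = β (f b) := DFunLike.congr_fun hf b
  have ha : f (α a) = β (f a) := DFunLike.congr_fun hf a
  rw [deviation, map_sub, ← tensorInt_map f hf, h, deviation, Algebra.TensorProduct.map_tmul,
    map_sub, hb, ha]

section Generic

variable {k : Type*} [CommRing k] {σ : Type*} {ν : σ → σ}

/-- The value on two variables of a braiding that is natural for the endomorphisms of a polynomial
algebra with a generic endomorphism. -/
theorem apply_d_ofA_X (hν : Function.Injective ν) {t x y : σ} (ht : ν t = t) (hx : x ≠ t)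
    (hy : y ≠ t)
    {R : Twisted (polyEnd k ν) ⊗[k] Twisted (polyEnd k ν) →ₗ[k]
      Twisted (polyEnd k ν) ⊗[k] Twisted (polyEnd k ν)}
    (h : (dg (polyEnd k ν)).IsDGBraiding R)
    (flip : ∀ a b, R (ofA _ a ⊗ₜ[k] ofA _ b) = ofA _ b ⊗ₜ[k] ofA _ a)
    (nat : ∀ (f : MvPolynomial σ k →ₐ[k] MvPolynomial σ k)
      (hf : f.comp (polyEnd k ν) = (polyEnd k ν).comp f),
      TensorProduct.map (map f hf).toLinearMap (map f hf).toLinearMap ∘ₗ R =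
        R ∘ₗ TensorProduct.map (map f hf).toLinearMap (map f hf).toLinearMap) :
    R ((dg (polyEnd k ν)).d (ofA _ (MvPolynomial.X x)) ⊗ₜ[k] ofA _ (MvPolynomial.X y)) =
      ofA _ (polyEnd k ν (MvPolynomial.X y)) ⊗ₜ[k]
        (dg (polyEnd k ν)).d (ofA _ (MvPolynomial.X x)) := by
  classical
  obtain ⟨δ, hδ⟩ := exists_leftInverse_mul_X (k := k) t
  have hνt : ∀ s, ν s = t ↔ s = t := fun s => ⟨fun e => hν (e.trans ht.symm), fun e => e ▸ ht⟩
  have hR := apply_d_ofA_mem h flip (t := MvPolynomial.X t) (by rw [polyEnd_X, ht, sub_self]) δ hδ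
  have hN : (MvPolynomial.X t : MvPolynomial σ k) - polyEnd k ν (MvPolynomial.X t) =
      MvPolynomial.X t := by rw [sub_polyEnd_X, ht]
  -- the projections onto the algebras generated by `t` and by the other variables
  let e : MvPolynomial σ k →ₐ[k] MvPolynomial σ k :=
    MvPolynomial.aeval fun s => if s = t then MvPolynomial.X t else 0
  let e' : MvPolynomial σ k →ₐ[k] MvPolynomial σ k :=
    MvPolynomial.aeval fun s => if s = t then 0 else MvPolynomial.X s
  have heX : ∀ s, e (MvPolynomial.X s) = if s = t then MvPolynomial.X t else 0 := fun s =>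
    MvPolynomial.aeval_X _ s
  have heX' : ∀ s, e' (MvPolynomial.X s) = if s = t then 0 else MvPolynomial.X s := fun s =>
    MvPolynomial.aeval_X _ s
  have he : e.comp (polyEnd k ν) = (polyEnd k ν).comp e := by
    refine MvPolynomial.algHom_ext fun s => ?_
    rw [AlgHom.comp_apply, AlgHom.comp_apply, polyEnd_X, map_sub, heX, heX, hνt]
    split_ifs
    · rw [polyEnd_X, ht, sub_self]
    · rw [sub_self, map_zero]
  have he' : e'.comp (polyEnd k ν) = (polyEnd k ν).comp e' := by
    refine MvPolynomial.algHom_ext fun s => ?_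
    rw [AlgHom.comp_apply, AlgHom.comp_apply, polyEnd_X, map_sub, heX', heX', hνt]
    split_ifs
    · rw [sub_self, map_zero]
    · rw [polyEnd_X]
  -- the identification of the two copies of `t`
  let f : MvPolynomial σ k →ₐ[k] MvPolynomial σ k ⊗[k] MvPolynomial σ k :=
    MvPolynomial.aeval fun s => if s = t then MvPolynomial.X t ⊗ₜ 1 else 1 ⊗ₜ MvPolynomial.X s
  have hfX : ∀ s, f (MvPolynomial.X s) = if s = t then MvPolynomial.X t ⊗ₜ 1 else
    1 ⊗ₜ MvPolynomial.X s := fun s => MvPolynomial.aeval_X _ s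
  let ψ : MvPolynomial σ k ⊗[k] MvPolynomial σ k →ₐ[k] MvPolynomial σ k ⊗[k] MvPolynomial σ k :=
    Algebra.TensorProduct.lift Algebra.TensorProduct.includeLeft f (fun _ _ => Commute.all _ _)
  have hψ : ∀ a b, ψ (a ⊗ₜ b) = (a ⊗ₜ 1) * f b := fun a b =>
    Algebra.TensorProduct.lift_tmul _ _ _ a b
  have hfe : ∀ a, f (e a) = e a ⊗ₜ 1 := by
    intro a
    refine DFunLike.congr_fun (f := f.comp e)
      (g := (Algebra.TensorProduct.includeLeft (R := k) (S := k)).comp e)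
      (MvPolynomial.algHom_ext fun s => ?_) a
    rw [AlgHom.comp_apply, AlgHom.comp_apply, heX]
    split_ifs
    · rw [hfX, if_pos rfl]; rfl
    · rw [map_zero, map_zero]
  have hfe' : ∀ a, f (e' a) = 1 ⊗ₜ e' a := by
    intro a
    refine DFunLike.congr_fun (f := f.comp e')
      (g := (Algebra.TensorProduct.includeRight (R := k)).comp e')
      (MvPolynomial.algHom_ext fun s => ?_) a
    rw [AlgHom.comp_apply, AlgHom.comp_apply, heX']
    split_ifs with hs
    · rw [map_zero, map_zero]
    · rw [hfX, if_neg hs]; rfl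
  -- On tensors involving only `t`, identifying the two copies of `t` amounts to multiplication.
  have hψe : ∀ T, ψ (Algebra.TensorProduct.map e e T) =
      e (Algebra.TensorProduct.lmul' k (S := MvPolynomial σ k) T) ⊗ₜ 1 := by
    intro T
    induction T using TensorProduct.induction_on with
    | zero => simp
    | tmul a b => simp [hψ, hfe]
    | add S T hS hT => simp only [map_add, hS, hT, TensorProduct.add_tmul]
  have hψe' : ∀ T, ψ (Algebra.TensorProduct.map e' e' T) = Algebra.TensorProduct.map e' e' T := by
    intro T
    induction T using TensorProduct.induction_on with
    | zero => simp
    | tmul a b => simp [hψ, hfe']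
    | add S T hS hT => simp only [map_add, hS, hT]
  -- Naturality under `e` shows that `D(t, t)` involves only `t`; its product is zero by
  -- `lmul_deviation`.
  have h1 : ψ (deviation R (MvPolynomial.X t) (MvPolynomial.X t)) = 0 := by
    have h2 := deviation_map e he (nat e he) (MvPolynomial.X t) (MvPolynomial.X t)
    rw [heX, if_pos rfl] at h2
    rw [← h2, hψe, lmul_deviation h.toIsBraiding hR, map_zero, TensorProduct.zero_tmul]
  -- Naturality under `e'` shows that `D(x, y)` does not involve `t`, so `ψ` fixes it.
  have h2 : ψ (deviation R (MvPolynomial.X x) (MvPolynomial.X y)) =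
      deviation R (MvPolynomial.X x) (MvPolynomial.X y) := by
    have h3 := deviation_map e' he' (nat e' he') (MvPolynomial.X x) (MvPolynomial.X y)
    rw [heX', if_neg hx, heX', if_neg hy] at h3
    rw [← h3, hψe']
  have h3 := deviation_right_comm h flip (MvPolynomial.X x) (MvPolynomial.X t) (MvPolynomial.X y)
  have h4 := deviation_left_comm h.toIsBraiding flip hR (MvPolynomial.X x) (MvPolynomial.X t)
    (MvPolynomial.X t)
  rw [hN] at h3 h4
  have hcancel : ∀ T : MvPolynomial σ k ⊗[k] MvPolynomial σ k,
      (MvPolynomial.X t ⊗ₜ 1) * T = 0 → T = 0 := by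
    intro T hT
    have h5 : ∀ T : MvPolynomial σ k ⊗[k] MvPolynomial σ k,
        TensorProduct.map δ LinearMap.id ((MvPolynomial.X t ⊗ₜ 1) * T) = T := by
      intro T
      induction T using TensorProduct.induction_on with
      | zero => simp
      | tmul a b => simp [hδ]
      | add S T hS hT => rw [mul_add, map_add, hS, hT]
    rw [← h5 T, hT, map_zero]
  have h5 : deviation R (MvPolynomial.X x) (MvPolynomial.X y) = 0 := by
    refine hcancel _ (hcancel _ ?_)
    have h6 : ψ (1 ⊗ₜ MvPolynomial.X t) = MvPolynomial.X t ⊗ₜ[k] (1 : MvPolynomial σ k) := by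
      rw [hψ, hfX, if_pos rfl, Algebra.TensorProduct.tmul_mul_tmul, one_mul, one_mul]
    have h7 : ψ (MvPolynomial.X t ⊗ₜ 1) = MvPolynomial.X t ⊗ₜ[k] (1 : MvPolynomial σ k) := by
      rw [hψ, map_one, mul_one]
    -- One exchange in each argument passes from `D(x, y)` to `D(t, t)`, using `t - α t = t`.
    have h8 : ((1 : MvPolynomial σ k) ⊗ₜ[k] MvPolynomial.X t) *
        ((MvPolynomial.X t ⊗ₜ 1) * deviation R (MvPolynomial.X x) (MvPolynomial.X y)) =
        ((MvPolynomial.X y - polyEnd k ν (MvPolynomial.X y)) ⊗ₜ[k] 1) *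
          ((1 ⊗ₜ[k] (MvPolynomial.X x - polyEnd k ν (MvPolynomial.X x))) *
            deviation R (MvPolynomial.X t) (MvPolynomial.X t)) := by
      rw [h3, mul_left_comm, h4]
    have h9 := congrArg ψ h8
    rwa [map_mul, map_mul, map_mul, map_mul, h1, mul_zero, mul_zero, h2, h6, h7] at h9
  -- A vanishing deviation determines `R(dX ⊗ Y)` because integration is injective on `Ω⁰ ⊗ Ω¹`.
  rw [← map_primitive_tensorInt hν (hR _ _), eq_add_of_sub_eq h5, zero_add, TensorProduct.map_tmul,
    ← intAug_d_ofA, primitive_intAug hν (d_ofA_mem _ _)]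
  rfl

end Generic

/-- The shift on the indices of the variables of the polynomial algebra that carries the universal
pair of elements of an algebra with endomorphism, and one more element in the kernel. -/
def pairShift : ULift.{v} (Option (Bool × ℕ)) → ULift.{v} (Option (Bool × ℕ)) :=
  fun s => ⟨s.down.map fun p => (p.1, p.2 + 1)⟩

theorem pairShift_injective : Function.Injective pairShift.{v} := by
  rintro ⟨s⟩ ⟨s'⟩ h
  have h' := congrArg ULift.down h
  refine congrArg ULift.up (Option.map_injective ?_ h')
  rintro ⟨a, m⟩ ⟨b, n⟩ h
  simpa using h

end Twisted

/-- Every pair `(a, b)` is the image of the generic pair: send the two families of variables to the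
iterates of `N = 1 - α` on `a` and on `b`, and the auxiliary variable to `0`. This commutes with the
endomorphisms since `α = 1 - N`. -/
theorem IsFunctorialBraiding.apply_d_ofA {k : Type u} [CommRing k] {R : Family.{u, v} k}
    (h : IsFunctorialBraiding R) (A : Type (max u v)) [CommRing A] [Algebra k A] (α : A →ₐ[k] A)
    (a b : A) : R A α ((Twisted.dg α).d (Twisted.ofA α a) ⊗ₜ[k] Twisted.ofA α b) =
      Twisted.ofA α (α b) ⊗ₜ[k] (Twisted.dg α).d (Twisted.ofA α a) := by
  have h1 := Twisted.apply_d_ofA_X (k := k) Twisted.pairShift_injective.{v} (t := ⟨none⟩)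
    (x := ⟨some (false, 0)⟩) (y := ⟨some (true, 0)⟩) rfl (by simp) (by simp)
    (h.isDGBraiding _ _) (h.flip _ _) (fun f hf => h.natural _ _ _ _ f hf)
  let N : A →ₗ[k] A := LinearMap.id - α.toLinearMap
  let φ : MvPolynomial (ULift.{v} (Option (Bool × ℕ))) k →ₐ[k] A :=
    MvPolynomial.aeval fun s => s.down.elim 0 fun p => N^[p.2] (if p.1 then b else a)
  have hφX : ∀ s, φ (MvPolynomial.X s) = s.down.elim 0 fun p => N^[p.2] (if p.1 then b else a) :=
    fun s => MvPolynomial.aeval_X _ s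
  have hφ : φ.comp (Twisted.polyEnd k Twisted.pairShift.{v}) = α.comp φ := by
    refine MvPolynomial.algHom_ext fun s => ?_
    rw [AlgHom.comp_apply, AlgHom.comp_apply, Twisted.polyEnd_X, map_sub, hφX, hφX]
    obtain ⟨_ | ⟨c, n⟩⟩ := s
    · simp [Twisted.pairShift]
    · simp only [Twisted.pairShift, Option.map_some, Option.elim_some, Function.iterate_succ_apply']
      simp [N]
  have h2 := LinearMap.congr_fun (h.natural _ _ _ _ φ hφ)
    ((Twisted.dg _).d (Twisted.ofA _ (MvPolynomial.X ⟨some (false, 0)⟩)) ⊗ₜ[k]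
      Twisted.ofA _ (MvPolynomial.X ⟨some (true, 0)⟩))
  have ha : φ (MvPolynomial.X ⟨some (false, 0)⟩) = a := by rw [hφX]; simp
  have hb : φ (MvPolynomial.X ⟨some (true, 0)⟩) = b := by rw [hφX]; simp
  have hb' := DFunLike.congr_fun hφ (MvPolynomial.X ⟨some (true, 0)⟩)
  rw [AlgHom.comp_apply, AlgHom.comp_apply, hb] at hb'
  rw [LinearMap.comp_apply, LinearMap.comp_apply, h1, TensorProduct.map_tmul,
    TensorProduct.map_tmul] at h2
  simp only [AlgHom.toLinearMap_apply, Twisted.map_d, Twisted.map_ofA, ha, hb, hb'] at h2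
  exact h2.symm

/-! ### Existence and uniqueness -/

theorem Twisted.braid_isFunctorialBraiding (k : Type u) [CommRing k] :
    IsFunctorialBraiding (k := k) (fun (A : Type (max u v)) _ _ α => Twisted.braid (A := A) α) where
  isDGBraiding _ _ _ α := Twisted.braid_isDGBraiding α
  flip _ _ _ α := Twisted.braid_ofA_ofA α
  natural _ _ _ _ _ _ _ _ f hf := Twisted.map_braid f hf

theorem IsFunctorialBraiding.eq_braid {k : Type u} [CommRing k] {R : Family.{u, v} k}
    (h : IsFunctorialBraiding R) (A : Type (max u v)) [CommRing A] [Algebra k A]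
    (α : A →ₐ[k] A) : R A α = Twisted.braid α :=
  Twisted.eq_braid_of_apply_d_ofA (h.isDGBraiding A α) (h.flip A α) (h.apply_d_ofA A α)

end TwistedForms

end

theorem theorem1 (k : Type u) [CommRing k] :
    (∃! R : Family.{u, v} k, IsFunctorialBraiding R) ∧
    ∀ R : Family.{u, v} k, IsFunctorialBraiding R →
      ∀ (A : Type (max u v)) [CommRing A] [Algebra k A] (α : A →ₐ[k] A),
        ∃ I : Twisted α →ₗ[k] Twisted α,
          IsIntegration α I ∧
          (∀ x, (Twisted.dg α).d (I x) + I ((Twisted.dg α).d x) = x - Twisted.bar α x) ∧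
          (∀ x, I (I x) = 0) ∧
          ∀ (p q : ℕ), ∀ ω ∈ (Twisted.dg α).deg p, ∀ φ ∈ (Twisted.dg α).deg q,
            R A α (ω ⊗ₜ[k] φ) =
              (-1 : k) ^ (p * q) • (((Twisted.bar α)^[p] φ) ⊗ₜ[k] ω) -
              (-1 : k) ^ ((p + 1) * q) •
                (I ((Twisted.bar α)^[p] φ) ⊗ₜ[k] (Twisted.dg α).d ω) := by
  refine ⟨⟨fun A _ _ α => Twisted.braid (A := A) α, Twisted.braid_isFunctorialBraiding k,
    fun R hR => ?_⟩, fun R hR A _ _ α => ⟨Twisted.int α, Twisted.int_isIntegration α,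
      Twisted.d_int α, Twisted.int_int α, fun p q ω hω φ hφ => ?_⟩⟩
  · funext A _ _ α
    exact hR.eq_braid A α
  · rw [hR.eq_braid A α, Twisted.braid_eq_int α hω hφ]
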